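/- Let $X=(X_s)_{s\ge 0}$ be a one-dimensional Lévy process (started at $0$, with stationary independent increments and almost surely right-continuous paths with left limits), with characteristic triplet $(a,\sigma,\Pi)$, where $a\in\mathbb{R}$, $\sigma\ge 0$ and $\Pi$ is a measure on $\mathbb{R}\setminus\{0\}$ with $\int(1\wedge x^2)\,\Pi(dx)<\infty$; that is, $\mathbb{E}[e^{i\theta X_s}]=e^{-s\Psi(\theta)}$ for all $s\ge 0$ and $\theta\in\mathbb{R}$, with $$\Psi(\theta)=ia\theta+\tfrac12\sigma^2\theta^2+\int_{\mathbb{R}}\bigl(1-e^{i\theta x}+i\theta x\mathbf 1_{\{|x|<1\}}\bigr)\,\Pi(dx).$$ Assume (A1): $\int_{|x|\ge 1}x^2\,\Pi(dx)<\infty$. Write $\overline X_s=\sup_{u\le s}X_u$. Let $t>0$ and, for $n\ge 1$, let $\mathbf g=\mathbf g(n,n/t)$ be a random time independent of $X$ having the Gamma distribution with shape $n$ and rate $n/t$. Then there is a constant $C>0$ depending only on $t$ and $(a,\sigma,\Pi)$ such that, for all $n\ge 1$, the random variables below have finite expectation and (i) $\mathbb{E}[(X_{\mathbf g}-X_t)^2]\le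 C n^{-1/2}$ and $\mathbb{E}[|X_{\mathbf g}-X_t|]\le C n^{-1/4}$; (ii) $\mathbb{E}[(\overline X_{\mathbf g}-\overline X_t)^2]\le C n^{-1/2}$ and $\mathbb{E}[|\overline X_{\mathbf g}-\overline X_t|]\le C n^{-1/4}$. If moreover $X$ is not a deterministic drift (that is, $\sigma\neq 0$ or $\Pi\neq 0$), then the first rate is exact: there is a constant $c>0$ depending only on $t$ and $(a,\sigma,\Pi)$ such that $c\,n^{-1/2}\le\mathbb{E}[(X_{\mathbf g}-X_t)^2]$ for all $n\ge 1$. If, in addition to (A1), the paths of $X$ are almost surely of bounded variation on compact time intervals, then there is a constant $C'>0$ depending only on $t$ and $(a,\sigma,\Pi)$ such that, for all $n\ge 1$, $$\mathbb{E}[|X_{\mathbf g}-X_t|]\le C' n^{-1/2}\quad\text{and}\quad \mathbb{E}[|\overline X_{\mathbf g}-\overline X_t|]\le C' n^{-1/2}.$$ -/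

import Mathlib

open MeasureTheory ProbabilityTheory Filter Topology
open scoped NNReal ENNReal

/-- `X` is a one-dimensional Lévy process under `P`: it starts at the origin, has independent and
stationary increments, and its paths are almost surely right-continuous with left limits.
(At time `0` the left-limit requirement is empty, as `𝓝[<] 0 = ⊥` in `ℝ≥0`.) -/
structure IsLevyProcess {Ω : Type*} [MeasurableSpace Ω] (X : ℝ≥0 → Ω → ℝ) (P : Measure Ω) :
    Prop where
  measurable : ∀ t, Measurable (X t)
  zero : ∀ᵐ ω ∂P, X 0 ω = 0
  indep_increments : HasIndepIncrements X P
  stationary_increments : ∀ s t, IdentDistrib (fun ω => X (s + t) ω - X s ω) (X t) P P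
  cadlag : ∀ᵐ ω ∂P, ∀ t : ℝ≥0,
    ContinuousWithinAt (fun s => X s ω) (Set.Ici t) t ∧
      ∃ l : ℝ, Tendsto (fun s => X s ω) (𝓝[<] t) (𝓝 l)

/-- `ν` is a Lévy measure: it is concentrated on `ℝ \ {0}` and `∫ (1 ∧ x²) ν(dx) < ∞`. -/
structure IsLevyMeasure (ν : Measure ℝ) : Prop where
  zero : ν {0} = 0
  lintegral_lt_top : ∫⁻ x, ENNReal.ofReal (min 1 (x ^ 2)) ∂ν < ∞

/-- The characteristic exponent of the triplet `(a, σ, ν)`: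
`Ψ(θ) = i a θ + σ² θ² / 2 + ∫ (1 - exp (i θ x) + i θ x 1_{|x| < 1}) ν(dx)`. -/
noncomputable def levyExponent (a σ : ℝ) (ν : Measure ℝ) (θ : ℝ) : ℂ :=
  Complex.I * a * θ + (1 / 2 : ℂ) * (σ : ℂ) ^ 2 * (θ : ℂ) ^ 2 +
    ∫ x : ℝ, (1 - Complex.exp (Complex.I * θ * x) +
      Set.indicator {x : ℝ | |x| < 1} (fun x : ℝ => Complex.I * (θ : ℂ) * (x : ℂ)) x) ∂ν

/-- `X` has characteristic triplet `(a, σ, ν)`: `E[exp (i θ X_t)] = exp (-t Ψ(θ))`. -/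
def HasLevyTriplet {Ω : Type*} [MeasurableSpace Ω] (X : ℝ≥0 → Ω → ℝ) (P : Measure Ω)
    (a σ : ℝ) (ν : Measure ℝ) : Prop :=
  ∀ (t : ℝ≥0) (θ : ℝ),
    charFun (P.map (X t)) θ = Complex.exp (-((t : ℝ) : ℂ) * levyExponent a σ ν θ)

/-- The running supremum `sup_{s ≤ t} X_s`. -/
noncomputable def runningSup {Ω : Type*} (X : ℝ≥0 → Ω → ℝ) (t : ℝ≥0) (ω : Ω) : ℝ :=
  ⨆ s : Set.Iic t, X s ω

/-- The paths of `X` are almost surely of bounded variation on every compact time interval. -/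
def HasBoundedVariationPaths {Ω : Type*} [MeasurableSpace Ω] (X : ℝ≥0 → Ω → ℝ)
    (P : Measure Ω) : Prop :=
  ∀ᵐ ω ∂P, LocallyBoundedVariationOn (fun s => X s ω) Set.univ

/-- `g` is a random time `g(n, n/t)`: it is Gamma distributed with shape `n` and rate `n / t`
(mean `t`), and it is independent of the whole process `X`. -/
structure IsGammaTime {Ω : Type*} [MeasurableSpace Ω] (g : Ω → ℝ≥0) (n : ℕ) (t : ℝ≥0)
    (X : ℝ≥0 → Ω → ℝ) (P : Measure Ω) : Prop where
  hasLaw : HasLaw (fun ω => (g ω : ℝ)) (gammaMeasure (n : ℝ) ((n : ℝ) / (t : ℝ))) P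
  indep : IndepFun g (fun ω s => X s ω) P

/-!
# Lévy processes at a Gamma time

By independence and stationarity of increments, the distance between `X_g` and `X_t` depends on `g`
only through `|g - t|`, so every estimate splits into a bound on increments of `X` over an interval
of length `h` and a bound on moments of `|g - t|`.

*Increments.* Since `ν` has a finite second moment, `Ψ(θ) = -iκθ + vθ²/2 + o(θ²)` at the origin.
Fatou's lemma applied to `(1 - Re φ(θ)) / θ²` turns this into square integrability of `X_h`, with
mean `κ h` and variance `v h` (`HasLevyTriplet.moments`). Hence `E (X_{s+h} - X_s)² = v h + κ² h²`,
and Doob's inequality for the centred increments over finer and finer grids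
(`integral_partialSups_sum_sq_le`) bounds the second moment of `sup_{[0,s+h]} X - sup_{[0,s]} X` by
`8 v h + 2 κ² h²`.

*Bounded variation.* The sums `S_N` of `|ΔX|` over the grid of mesh `1 / N` on `[0, 1]` are bounded
in `N` almost surely, and their variances are at most `v + κ²`. By Chebyshev's inequality their means
`N E|X_{1/N}|` are bounded too (`IsLevyProcess.exists_lintegral_enorm_le`), so that
`E|X_h| ≤ C h`; no Lévy–Itô decomposition is needed. Summing over a grid gives the same bound for
the increments of the running supremum. The constant depends only on the triplet because the triplet
determines the law of each `X_h`.

*The random time.* The evaluation `(s, ω) ↦ X_s ω` is replaced by a jointly measurable function of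
the time and the path, which agrees with it on right-continuous paths, and Fubini's theorem applies
(`lintegral_comp_independent_time`). The first absolute central moment of `g` is of exact order
`n ^ (-1/2)`: it is at most the standard deviation `t n ^ (-1/2)`, and the lower bound, which makes
the rate exact when `v > 0`, follows by comparing the second moment with the fourth
(`IsGammaTime.le_integral_abs`).
-/

/-! ### The second order behaviour of a characteristic function at the origin -/

lemma one_sub_cos_div_sq {θ : ℝ} (hθ : θ ≠ 0) (x : ℝ) :
    (1 - Real.cos (θ * x)) / θ ^ 2 = 1 / 2 * (x * Real.sinc (θ * x / 2)) ^ 2 := by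
  rcases eq_or_ne x 0 with rfl | hx
  · simp
  · rw [Real.sinc_of_ne_zero (by positivity)]
    have h : Real.cos (θ * x) = 1 - 2 * Real.sin (θ * x / 2) ^ 2 := by
      rw [← Real.cos_sq_add_sin_sq (θ * x / 2)]
      conv_lhs => rw [show θ * x = 2 * (θ * x / 2) by ring, Real.cos_two_mul']
      ring
    rw [h]
    field_simp
    ring

lemma sin_mul_div {θ : ℝ} (hθ : θ ≠ 0) (x : ℝ) :
    Real.sin (θ * x) / θ = x * Real.sinc (θ * x) := by
  rcases eq_or_ne x 0 with rfl | hx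
  · simp
  · rw [Real.sinc_of_ne_zero (by positivity)]
    field_simp

lemma integrable_exp_mul_I (μ : Measure ℝ) [IsProbabilityMeasure μ] (s : ℝ) :
    Integrable (fun x : ℝ => Complex.exp (s * x * Complex.I)) μ := by
  refine Integrable.of_bound (C := 1) (by fun_prop) (ae_of_all _ fun x => ?_)
  rw [← Complex.ofReal_mul, Complex.norm_exp_ofReal_mul_I]

lemma re_charFun (μ : Measure ℝ) [IsProbabilityMeasure μ] (s : ℝ) :
    (charFun μ s).re = ∫ x, Real.cos (s * x) ∂μ := by
  rw [charFun_apply_real]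
  have h := integral_re (𝕜 := ℂ) (integrable_exp_mul_I μ s)
  simp only [RCLike.re_to_complex] at h
  rw [← h]
  refine integral_congr_ae (ae_of_all _ fun x => ?_)
  simp only
  rw [← Complex.ofReal_mul, Complex.exp_ofReal_mul_I_re]

lemma im_charFun (μ : Measure ℝ) [IsProbabilityMeasure μ] (s : ℝ) :
    (charFun μ s).im = ∫ x, Real.sin (s * x) ∂μ := by
  rw [charFun_apply_real]
  have h := integral_im (𝕜 := ℂ) (integrable_exp_mul_I μ s)
  simp only [RCLike.im_to_complex] at h
  rw [← h]
  refine integral_congr_ae (ae_of_all _ fun x => ?_)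
  simp only
  rw [← Complex.ofReal_mul, Complex.exp_ofReal_mul_I_im]

lemma integral_sinc_sq_eq (μ : Measure ℝ) [IsProbabilityMeasure μ] {s : ℝ} (hs : s ≠ 0) :
    ∫ x, 1 / 2 * (x * Real.sinc (s * x / 2)) ^ 2 ∂μ = ((1 - charFun μ s) / (s : ℂ) ^ 2).re := by
  simp_rw [← one_sub_cos_div_sq hs]
  rw [integral_div, integral_sub (integrable_const _), ← re_charFun]
  · rw [← Complex.ofReal_pow, Complex.div_ofReal_re]
    simp
  · exact Integrable.of_bound (C := 1) (by fun_prop)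
      (ae_of_all _ fun x => by simpa using Real.abs_cos_le_one _)

/-- A second order expansion `1 - L θ² / 2` of the characteristic function along a single null
sequence already gives a finite second moment equal to `L`, and mean zero. Fatou's lemma gives the
finiteness, after which dominated convergence identifies both moments. -/
lemma memLp_two_of_tendsto_charFun {μ : Measure ℝ} [IsProbabilityMeasure μ] {L : ℝ} {θ : ℕ → ℝ}
    (hθ : ∀ n, θ n ≠ 0) (hθ0 : Tendsto θ atTop (𝓝 0))
    (h : Tendsto (fun n => (1 - charFun μ (θ n)) / (θ n : ℂ) ^ 2) atTop (𝓝 ((L / 2 : ℝ) : ℂ))) :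
    MemLp id 2 μ ∧ ∫ x, x ∂μ = 0 ∧ ∫ x, x ^ 2 ∂μ = L := by
  set f : ℕ → ℝ → ℝ := fun n x => 1 / 2 * (x * Real.sinc (θ n * x / 2)) ^ 2 with hf
  have hfm : ∀ n, Measurable (f n) := fun n => by
    have := Real.continuous_sinc.measurable
    fun_prop
  have hf0 : ∀ n x, 0 ≤ f n x := fun n x => by positivity
  have hfint : ∀ n, Integrable (f n) μ := fun n => by
    refine Integrable.of_bound (C := 2 / θ n ^ 2) (hfm n).aestronglyMeasurable
      (ae_of_all _ fun x => ?_)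
    rw [Real.norm_of_nonneg (hf0 n x)]
    simp only [hf]
    rw [← one_sub_cos_div_sq (hθ n)]
    gcongr
    linarith [Real.neg_one_le_cos (θ n * x)]
  have hflim : ∀ x, Tendsto (fun n => f n x) atTop (𝓝 (1 / 2 * x ^ 2)) := fun x => by
    have h1 : Tendsto (fun n => Real.sinc (θ n * x / 2)) atTop (𝓝 1) := by
      rw [← Real.sinc_zero]
      refine (Real.continuous_sinc.tendsto 0).comp ?_
      simpa using (hθ0.mul_const x).div_const 2
    simpa only [mul_one] using ((h1.const_mul x).pow 2).const_mul (1 / 2)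
  have hre : Tendsto (fun n => ∫ x, f n x ∂μ) atTop (𝓝 (L / 2)) := by
    have := (Complex.continuous_re.tendsto _).comp h
    simp only [Complex.ofReal_re] at this
    refine this.congr fun n => ?_
    simp only [hf, Function.comp]
    rw [integral_sinc_sq_eq μ (hθ n)]
  have hfatou : ∫⁻ x, ENNReal.ofReal (1 / 2 * x ^ 2) ∂μ ≤ ENNReal.ofReal (L / 2) := by
    calc ∫⁻ x, ENNReal.ofReal (1 / 2 * x ^ 2) ∂μ
        = ∫⁻ x, liminf (fun n => ENNReal.ofReal (f n x)) atTop ∂μ := by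
          refine lintegral_congr fun x => ?_
          exact ((ENNReal.continuous_ofReal.tendsto _).comp (hflim x)).liminf_eq.symm
      _ ≤ liminf (fun n => ∫⁻ x, ENNReal.ofReal (f n x) ∂μ) atTop :=
          lintegral_liminf_le fun n => (hfm n).ennreal_ofReal
      _ = ENNReal.ofReal (L / 2) := by
          simp_rw [← fun n => ofReal_integral_eq_lintegral_ofReal (hfint n)
            (ae_of_all _ (hf0 n))]
          exact ((ENNReal.continuous_ofReal.tendsto _).comp hre).liminf_eq
  have hint : Integrable (fun x : ℝ => 1 / 2 * x ^ 2) μ := by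
    refine ⟨by fun_prop, ?_⟩
    rw [hasFiniteIntegral_iff_ofReal (ae_of_all _ fun x => by positivity)]
    exact hfatou.trans_lt ENNReal.ofReal_lt_top
  have hint2 : Integrable (fun x : ℝ => x ^ 2) μ := by
    simpa using hint.const_mul 2
  have hmem : MemLp id 2 μ := (memLp_two_iff_integrable_sq (by fun_prop)).2 hint2
  have hint1 : Integrable (fun x : ℝ => x) μ := hmem.integrable one_le_two
  refine ⟨hmem, ?_, ?_⟩
  · have h1 : Tendsto (fun n => ∫ x, x * Real.sinc (θ n * x) ∂μ) atTop (𝓝 (∫ x, x ∂μ)) := by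
      refine tendsto_integral_of_dominated_convergence (fun x => |x|) (fun n => ?_) hint1.abs
        (fun n => ae_of_all _ fun x => ?_) (ae_of_all _ fun x => ?_)
      · have := Real.continuous_sinc.measurable
        fun_prop
      · rw [norm_mul]
        exact mul_le_of_le_one_right (abs_nonneg x) (Real.abs_sinc_le_one _)
      · have h1 : Tendsto (fun n => Real.sinc (θ n * x)) atTop (𝓝 1) := by
          rw [← Real.sinc_zero]
          refine (Real.continuous_sinc.tendsto 0).comp ?_
          simpa using (hθ0.mul_const x)
        simpa using (h1.const_mul x)
    have h2 : Tendsto (fun n => ∫ x, x * Real.sinc (θ n * x) ∂μ) atTop (𝓝 0) := by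
      have h3 : Tendsto (fun n => -((1 - charFun μ (θ n)) / (θ n : ℂ) ^ 2).im * θ n) atTop
          (𝓝 (-((L / 2 : ℝ) : ℂ).im * 0)) :=
        (((Complex.continuous_im.tendsto _).comp h).neg).mul hθ0
      rw [mul_zero] at h3
      refine h3.congr fun n => ?_
      simp_rw [← sin_mul_div (hθ n)]
      rw [integral_div, ← im_charFun, ← Complex.ofReal_pow, Complex.div_ofReal_im]
      have := hθ n
      simp
      field_simp
    exact tendsto_nhds_unique h1 h2
  · have h1 : Tendsto (fun n => ∫ x, f n x ∂μ) atTop (𝓝 (∫ x, 1 / 2 * x ^ 2 ∂μ)) := by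
      refine tendsto_integral_of_dominated_convergence (fun x => 1 / 2 * x ^ 2)
        (fun n => (hfm n).aestronglyMeasurable) hint
        (fun n => ae_of_all _ fun x => ?_) (ae_of_all _ hflim)
      rw [Real.norm_of_nonneg (hf0 n x)]
      simp only [hf, mul_pow]
      have : Real.sinc (θ n * x / 2) ^ 2 ≤ 1 := by
        rw [sq_le_one_iff_abs_le_one]; exact Real.abs_sinc_le_one _
      nlinarith [sq_nonneg x]
    have := tendsto_nhds_unique h1 hre
    rw [integral_const_mul] at this
    linarith

/-! ### Mean and variance from the characteristic triplet -/

/-- The mean of `X₁` for a Lévy process `X` with triplet `(a, σ, ν)`. -/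
noncomputable def levyMean (a : ℝ) (ν : Measure ℝ) : ℝ :=
  -a + ∫ x in {x : ℝ | 1 ≤ |x|}, x ∂ν

/-- The variance of `X₁` for a Lévy process `X` with triplet `(a, σ, ν)`. -/
noncomputable def levyVar (σ : ℝ) (ν : Measure ℝ) : ℝ :=
  σ ^ 2 + ∫ x, x ^ 2 ∂ν

lemma levyVar_nonneg (σ : ℝ) (ν : Measure ℝ) : 0 ≤ levyVar σ ν :=
  add_nonneg (sq_nonneg _) (integral_nonneg fun _ => sq_nonneg _)

lemma measurableSet_one_le_abs : MeasurableSet {x : ℝ | 1 ≤ |x|} :=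
  measurableSet_le measurable_const (by fun_prop)

lemma IsLevyMeasure.integrable_sq {ν : Measure ℝ} (hν : IsLevyMeasure ν)
    (hA1 : ∫⁻ x in {x : ℝ | 1 ≤ |x|}, ENNReal.ofReal (x ^ 2) ∂ν < ∞) :
    Integrable (fun x : ℝ => x ^ 2) ν := by
  refine ⟨by fun_prop, ?_⟩
  rw [hasFiniteIntegral_iff_ofReal (ae_of_all _ fun x => sq_nonneg x),
    ← lintegral_add_compl _ measurableSet_one_le_abs]
  refine ENNReal.add_lt_top.2 ⟨hA1, ?_⟩
  refine lt_of_le_of_lt ?_ hν.lintegral_lt_top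
  refine le_trans (setLIntegral_mono' measurableSet_one_le_abs.compl fun x hx => ?_)
    (setLIntegral_le_lintegral _ _)
  refine ENNReal.ofReal_le_ofReal (le_min ?_ le_rfl)
  simp only [Set.mem_compl_iff, Set.mem_ofPred_eq, not_le] at hx
  rw [sq_le_one_iff_abs_le_one]
  exact hx.le

lemma norm_one_sub_exp_add_le (y : ℝ) :
    ‖1 - Complex.exp (Complex.I * y) + Complex.I * y‖ ≤ 3 * y ^ 2 := by
  have hn : ‖Complex.I * (y : ℂ)‖ = |y| := by simp
  rcases le_total |y| 1 with h | h
  · rw [← norm_neg, show -(1 - Complex.exp (Complex.I * y) + Complex.I * y)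
      = Complex.exp (Complex.I * y) - 1 - Complex.I * y by ring]
    refine (Complex.norm_exp_sub_one_sub_id_le (by rwa [hn])).trans ?_
    rw [hn, sq_abs]
    nlinarith [sq_nonneg y]
  · have h1 : ‖Complex.exp (Complex.I * y)‖ = 1 := by
      rw [mul_comm, Complex.norm_exp_ofReal_mul_I]
    calc _ ≤ ‖(1 : ℂ)‖ + ‖Complex.exp (Complex.I * y)‖ + ‖Complex.I * (y : ℂ)‖ :=
          (norm_add_le _ _).trans (by gcongr; exact norm_sub_le _ _)
      _ ≤ 3 * |y| ^ 2 := by rw [h1, hn, norm_one]; nlinarith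
      _ = 3 * y ^ 2 := by rw [sq_abs]

lemma tendsto_one_sub_exp_add_div_sq {θ : ℕ → ℝ} (hθ : ∀ n, θ n ≠ 0)
    (hθ0 : Tendsto θ atTop (𝓝 0)) (x : ℝ) :
    Tendsto (fun n => (1 - Complex.exp (Complex.I * θ n * x) + Complex.I * θ n * x) /
      (θ n : ℂ) ^ 2) atTop (𝓝 (((x ^ 2 / 2 : ℝ) : ℂ))) := by
  rw [tendsto_iff_norm_sub_tendsto_zero]
  have hlim : Tendsto (fun n => |θ n| * |x| ^ 3 * Real.exp (|θ n| * |x|)) atTop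
      (𝓝 (|0| * |x| ^ 3 * Real.exp (|0| * |x|))) := by
    have := hθ0.abs
    exact (this.mul_const _).mul ((Real.continuous_exp.tendsto _).comp (this.mul_const _))
  simp only [abs_zero, zero_mul] at hlim
  refine squeeze_zero (fun _ => norm_nonneg _) (fun n => ?_) hlim
  have hc : (θ n : ℂ) ≠ 0 := by exact_mod_cast hθ n
  have hb := Complex.norm_exp_sub_sum_le_norm_mul_exp (Complex.I * θ n * x) 3
  have hI : Complex.I ^ 2 = -1 := Complex.I_sq
  have heq : (1 - Complex.exp (Complex.I * θ n * x) + Complex.I * θ n * x) / (θ n : ℂ) ^ 2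
      - ((x ^ 2 / 2 : ℝ) : ℂ) = -(Complex.exp (Complex.I * θ n * x) -
      ∑ m ∈ Finset.range 3, (Complex.I * θ n * x) ^ m / (m.factorial : ℂ)) / (θ n : ℂ) ^ 2 := by
    simp only [Finset.sum_range_succ, Finset.sum_range_zero, Nat.factorial]
    push_cast
    field_simp
    rw [hI]
    ring
  rw [heq, norm_div, norm_neg]
  have hn : ‖Complex.I * (θ n : ℂ) * (x : ℂ)‖ = |θ n| * |x| := by simp
  rw [hn] at hb
  have hp : 0 < |θ n| := abs_pos.2 (hθ n)
  rw [norm_pow, Complex.norm_real, Real.norm_eq_abs, div_le_iff₀ (by positivity)]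
  refine hb.trans (le_of_eq ?_)
  ring

/-- Separating the mean from the characteristic exponent leaves the fully compensated integral. -/
lemma levyExponent_eq (a σ : ℝ) {ν : Measure ℝ} (hsq : Integrable (fun x : ℝ => x ^ 2) ν)
    (θ : ℝ) :
    levyExponent a σ ν θ = -(Complex.I * levyMean a ν * θ) + ((1 / 2 : ℂ) * σ ^ 2 * θ ^ 2 +
      ∫ x : ℝ, (1 - Complex.exp (Complex.I * θ * x) + Complex.I * θ * x) ∂ν) := by
  have hint : Integrable (fun x : ℝ =>
      1 - Complex.exp (Complex.I * θ * x) + Complex.I * θ * x) ν := by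
    refine Integrable.mono' (hsq.const_mul (3 * θ ^ 2)) (by fun_prop) (ae_of_all _ fun x => ?_)
    have := norm_one_sub_exp_add_le (θ * x)
    push_cast at this
    simp only [mul_assoc] at this ⊢
    refine this.trans (le_of_eq ?_)
    ring
  have hx : Integrable (({x : ℝ | 1 ≤ |x|}).indicator fun x => x) ν := by
    refine Integrable.mono' hsq
      (measurable_id.indicator measurableSet_one_le_abs).aestronglyMeasurable
      (ae_of_all _ fun x => ?_)
    by_cases h : 1 ≤ |x|
    · rw [Set.indicator_of_mem (by exact h), Real.norm_eq_abs, ← sq_abs]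
      nlinarith
    · rw [Set.indicator_of_notMem (by exact h)]
      simp [sq_nonneg]
  have hsplit : ∀ x : ℝ, (1 - Complex.exp (Complex.I * θ * x) +
      Set.indicator {x : ℝ | |x| < 1} (fun x : ℝ => Complex.I * (θ : ℂ) * (x : ℂ)) x) =
      (1 - Complex.exp (Complex.I * θ * x) + Complex.I * θ * x) -
        Complex.I * θ * ((({x : ℝ | 1 ≤ |x|}).indicator (fun x => x) x : ℝ) : ℂ) := by
    intro x
    by_cases h : 1 ≤ |x|
    · rw [Set.indicator_of_mem (s := {x : ℝ | 1 ≤ |x|}) (by exact h),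
        Set.indicator_of_notMem (by simpa using h)]
      ring
    · rw [Set.indicator_of_notMem (s := {x : ℝ | 1 ≤ |x|}) (by exact h),
        Set.indicator_of_mem (by simpa using h)]
      simp
  have hxc : Integrable (fun x : ℝ => Complex.I * θ *
      ((({x : ℝ | 1 ≤ |x|}).indicator (fun x => x) x : ℝ) : ℂ)) ν := hx.ofReal.const_mul _
  unfold levyExponent levyMean
  rw [integral_congr_ae (ae_of_all _ hsplit), integral_sub hint hxc,
    integral_const_mul, integral_complex_ofReal, integral_indicator measurableSet_one_le_abs]
  push_cast
  ring

/-- Once the mean is removed, the exponent is equivalent to `v θ² / 2` at the origin. -/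
lemma tendsto_levyExponent_div_sq (σ : ℝ) {ν : Measure ℝ}
    (hsq : Integrable (fun x : ℝ => x ^ 2) ν)
    {θ : ℕ → ℝ} (hθ : ∀ n, θ n ≠ 0) (hθ0 : Tendsto θ atTop (𝓝 0)) :
    Tendsto (fun n => ((1 / 2 : ℂ) * σ ^ 2 * θ n ^ 2 +
      ∫ x : ℝ, (1 - Complex.exp (Complex.I * θ n * x) + Complex.I * θ n * x) ∂ν) / (θ n : ℂ) ^ 2)
      atTop (𝓝 ((levyVar σ ν / 2 : ℝ) : ℂ)) := by
  have h : Tendsto (fun n => ∫ x : ℝ, (1 - Complex.exp (Complex.I * θ n * x) +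
      Complex.I * θ n * x) / (θ n : ℂ) ^ 2 ∂ν) atTop (𝓝 (∫ x : ℝ, ((x ^ 2 / 2 : ℝ) : ℂ) ∂ν)) := by
    refine tendsto_integral_of_dominated_convergence (fun x => 3 * x ^ 2)
      (fun n => by fun_prop) (hsq.const_mul 3) (fun n => ae_of_all _ fun x => ?_)
      (ae_of_all _ (tendsto_one_sub_exp_add_div_sq hθ hθ0))
    have hp := hθ n
    have := norm_one_sub_exp_add_le (θ n * x)
    push_cast at this
    rw [norm_div, norm_pow, Complex.norm_real, Real.norm_eq_abs, sq_abs,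
      div_le_iff₀ (by positivity)]
    simp only [mul_assoc] at this ⊢
    refine this.trans (le_of_eq ?_)
    ring
  have h2 := h.const_add ((1 / 2 : ℂ) * σ ^ 2)
  have heq : ((levyVar σ ν / 2 : ℝ) : ℂ) =
      (1 / 2 : ℂ) * σ ^ 2 + ∫ x : ℝ, ((x ^ 2 / 2 : ℝ) : ℂ) ∂ν := by
    rw [integral_complex_ofReal, integral_div]
    unfold levyVar
    push_cast
    ring
  rw [heq]
  refine h2.congr fun n => ?_
  have hc : (θ n : ℂ) ≠ 0 := by exact_mod_cast hθ n
  rw [integral_div]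
  field_simp

lemma tendsto_one_sub_exp_div_sq {J : ℕ → ℂ} {θ : ℕ → ℝ} {L : ℂ}
    (hθ : ∀ n, θ n ≠ 0) (hθ0 : Tendsto θ atTop (𝓝 0))
    (hJ : Tendsto (fun n => J n / (θ n : ℂ) ^ 2) atTop (𝓝 L)) :
    Tendsto (fun n => (1 - Complex.exp (-J n)) / (θ n : ℂ) ^ 2) atTop (𝓝 L) := by
  have hc : ∀ n, (θ n : ℂ) ≠ 0 := fun n => by exact_mod_cast hθ n
  have hθc : Tendsto (fun n => (θ n : ℂ) ^ 2) atTop (𝓝 0) := by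
    have := ((Complex.continuous_ofReal.tendsto 0).comp hθ0).pow 2
    simpa using this
  have hJ0 : Tendsto J atTop (𝓝 0) := by
    have := hJ.mul hθc
    rw [mul_zero] at this
    refine this.congr fun n => ?_
    have := hc n
    field_simp
  -- `1 - exp (-z) = z * dslope exp 0 (-z)`, where `dslope` also covers the case `z = 0`
  have hd : Tendsto (fun n => dslope Complex.exp 0 (-J n)) atTop (𝓝 1) := by
    have hcont : ContinuousAt (dslope Complex.exp 0) 0 :=
      continuousAt_dslope_same.2 Complex.differentiable_exp.differentiableAt
    have h1 : dslope Complex.exp 0 0 = 1 := by simp [dslope_same]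
    rw [← h1]
    refine hcont.tendsto.comp ?_
    simpa using hJ0.neg
  have := hJ.mul hd
  rw [mul_one] at this
  refine this.congr fun n => ?_
  have h2 := sub_smul_dslope Complex.exp 0 (-J n)
  simp only [sub_zero, smul_eq_mul, Complex.exp_zero] at h2
  rw [div_mul_eq_mul_div, show J n * dslope Complex.exp 0 (-J n) = 1 - Complex.exp (-J n) by
    linear_combination -h2]

/-- Under the second moment assumption on `ν`, `X_h` is square integrable with mean
`h * levyMean` and variance `h * levyVar`. -/
lemma HasLevyTriplet.moments {Ω : Type*} [MeasurableSpace Ω] {P : Measure Ω}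
    [IsProbabilityMeasure P] {X : ℝ≥0 → Ω → ℝ} {a σ : ℝ} {ν : Measure ℝ}
    (hX : ∀ t, Measurable (X t)) (hT : HasLevyTriplet X P a σ ν)
    (hsq : Integrable (fun x : ℝ => x ^ 2) ν) (h : ℝ≥0) :
    MemLp (fun ω => X h ω - levyMean a ν * h) 2 P ∧
      ∫ ω, (X h ω - levyMean a ν * h) ∂P = 0 ∧
      ∫ ω, (X h ω - levyMean a ν * h) ^ 2 ∂P = levyVar σ ν * h := by
  have hm : Measurable (fun ω => X h ω - levyMean a ν * h) := (hX h).sub_const _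
  have : IsProbabilityMeasure (P.map fun ω => X h ω - levyMean a ν * h) :=
    Measure.isProbabilityMeasure_map hm.aemeasurable
  have hmap : P.map (fun ω => X h ω - levyMean a ν * h) =
      (P.map (X h)).map (fun x => x + -(levyMean a ν * h)) := by
    rw [Measure.map_map (by fun_prop) (hX h)]
    rfl
  have key := memLp_two_of_tendsto_charFun (μ := P.map fun ω => X h ω - levyMean a ν * h)
    (L := levyVar σ ν * h) (θ := fun n => 1 / ((n : ℝ) + 1)) (fun n => by positivity)
    tendsto_one_div_add_atTop_nhds_zero_nat ?_
  · rw [memLp_map_measure_iff (by fun_prop) hm.aemeasurable,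
      integral_map hm.aemeasurable (by fun_prop), integral_map hm.aemeasurable (by fun_prop)] at key
    exact key
  · have h1 := tendsto_one_sub_exp_div_sq (θ := fun n : ℕ => 1 / ((n : ℝ) + 1))
      (fun n => by positivity) tendsto_one_div_add_atTop_nhds_zero_nat
      (((tendsto_levyExponent_div_sq σ hsq (θ := fun n : ℕ => 1 / ((n : ℝ) + 1))
      (fun n => by positivity) tendsto_one_div_add_atTop_nhds_zero_nat).const_mul
        ((h : ℝ) : ℂ)).congr fun n => (mul_div_assoc _ _ _).symm)
    rw [show ((levyVar σ ν * h / 2 : ℝ) : ℂ) = ((h : ℝ) : ℂ) * ((levyVar σ ν / 2 : ℝ) : ℂ) by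
      push_cast; ring]
    refine h1.congr fun n => ?_
    rw [hmap, charFun_map_add_const, hT, levyExponent_eq a σ hsq, ← Complex.exp_add]
    congr 3
    simp
    ring

/-! ### Doob's maximal inequality for sums of independent variables -/

/-- The pathwise inequality behind Doob's `L²` maximal inequality. -/
lemma partialSups_sq_le (S : ℕ → ℝ) (n : ℕ) :
    partialSups S n ^ 2 ≤ 2 * (S n * partialSups S n) -
      2 * ∑ k ∈ Finset.range n, partialSups S k * (S (k + 1) - S k) := by
  induction n with
  | zero => simp; nlinarith [sq_nonneg (S 0)]
  | succ n ih =>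
    rw [Finset.sum_range_succ, partialSups_add_one]
    rcases le_total (partialSups S n) (S (n + 1)) with h | h
    · rw [sup_eq_right.2 h]
      nlinarith [sq_nonneg (S (n + 1) - partialSups S n)]
    · rw [sup_eq_left.2 h]
      nlinarith

section Doob

variable {Ω : Type*} [MeasurableSpace Ω] {P : Measure Ω} {ξ : ℕ → Ω → ℝ}

lemma measurable_partialSups_apply {S : ℕ → Ω → ℝ} (n : ℕ) (hS : ∀ k ≤ n, Measurable (S k)) :
    Measurable fun ω => partialSups (fun k => S k ω) n := by
  induction n with
  | zero => simpa using hS 0 le_rfl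
  | succ n ih =>
    simp only [partialSups_add_one]
    exact (ih fun k hk => hS k (hk.trans n.le_succ)).sup (hS _ le_rfl)

lemma memLp_partialSups_apply {S : ℕ → Ω → ℝ} {p : ℝ≥0∞} (hS : ∀ k, MemLp (S k) p P) (n : ℕ) :
    MemLp (fun ω => partialSups (fun k => S k ω) n) p P := by
  induction n with
  | zero => simpa using hS 0
  | succ n ih =>
    simp only [partialSups_add_one]
    exact ih.sup (hS _)

lemma partialSups_congr_le {f g : ℕ → ℝ} {n : ℕ} (h : ∀ k ≤ n, f k = g k) :
    partialSups f n = partialSups g n :=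
  le_antisymm (partialSups_le _ _ _ fun k hk => (h k hk).trans_le (le_partialSups_of_le _ hk))
    (partialSups_le _ _ _ fun k hk => (h k hk).symm.trans_le (le_partialSups_of_le _ hk))

lemma indepFun_partialSups_sum (hξ : ∀ i, Measurable (ξ i)) (hind : iIndepFun ξ P) (k : ℕ) :
    IndepFun (fun ω => partialSups (fun j => ∑ i ∈ Finset.range j, ξ i ω) k) (ξ k) P := by
  have h := hind.indepFun_finset (Finset.range k) {k} (by simp) hξ
  set φ : (Finset.range k → ℝ) → ℝ := fun y =>
    partialSups (fun j => ∑ i ∈ Finset.range j,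
      if hi : i ∈ Finset.range k then y ⟨i, hi⟩ else 0) k with hφ
  have hφm : Measurable φ := by
    refine measurable_partialSups_apply
      (S := fun j (y : Finset.range k → ℝ) => ∑ i ∈ Finset.range j,
        if hi : i ∈ Finset.range k then y ⟨i, hi⟩ else 0) k fun j _ => ?_
    refine Finset.measurable_fun_sum _ fun i _ => ?_
    split_ifs <;> fun_prop
  have h2 := h.comp hφm (measurable_pi_apply ⟨k, Finset.mem_singleton_self k⟩)
  refine h2.congr (ae_of_all _ fun ω => ?_) (ae_of_all _ fun ω => rfl)
  simp only [Function.comp, hφ]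
  refine partialSups_congr_le fun j hj => Finset.sum_congr rfl fun i hi => ?_
  rw [dif_pos (Finset.mem_range.2 ((Finset.mem_range.1 hi).trans_le hj))]

/-- **Doob's `L²` maximal inequality** for the partial sums of independent centred variables. -/
lemma integral_partialSups_sum_sq_le [IsProbabilityMeasure P] (hξ : ∀ i, Measurable (ξ i))
    (hind : iIndepFun ξ P) (hL : ∀ i, MemLp (ξ i) 2 P) (h0 : ∀ i, ∫ ω, ξ i ω ∂P = 0) (n : ℕ) :
    ∫ ω, partialSups (fun k => ∑ i ∈ Finset.range k, ξ i ω) n ^ 2 ∂P ≤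
      4 * ∫ ω, (∑ i ∈ Finset.range n, ξ i ω) ^ 2 ∂P := by
  have hS : ∀ k, MemLp (fun ω => ∑ i ∈ Finset.range k, ξ i ω) 2 P := fun k =>
    memLp_finsetSum _ fun i _ => hL i
  have hM : ∀ k, MemLp (fun ω => partialSups (fun k => ∑ i ∈ Finset.range k, ξ i ω) k) 2 P :=
    memLp_partialSups_apply hS
  have hcross : ∀ k, ∫ ω, partialSups (fun k => ∑ i ∈ Finset.range k, ξ i ω) k * ξ k ω ∂P = 0 :=
    fun k => by
      have := (indepFun_partialSups_sum hξ hind k).integral_mul_eq_mul_integral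
        (hM k).aestronglyMeasurable (hL k).aestronglyMeasurable
      simpa [h0 k] using this
  have hprod : ∀ k, Integrable (fun ω =>
      partialSups (fun k => ∑ i ∈ Finset.range k, ξ i ω) k * ξ k ω) P :=
    fun k => (hM k).integrable_mul (hL k)
  have hi1 := (hM n).integrable_sq
  have hi2 := (hS n).integrable_sq
  have hi3 : Integrable (fun ω => ∑ k ∈ Finset.range n,
      partialSups (fun k => ∑ i ∈ Finset.range k, ξ i ω) k * ξ k ω) P :=
    integrable_finsetSum _ fun k _ => hprod k
  have hpath : ∀ ω, partialSups (fun k => ∑ i ∈ Finset.range k, ξ i ω) n ^ 2 ≤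
      4 * (∑ i ∈ Finset.range n, ξ i ω) ^ 2 - 4 * ∑ k ∈ Finset.range n,
        partialSups (fun k => ∑ i ∈ Finset.range k, ξ i ω) k * ξ k ω := fun ω => by
    have := partialSups_sq_le (fun k => ∑ i ∈ Finset.range k, ξ i ω) n
    simp only [Finset.sum_range_succ, add_sub_cancel_left] at this
    nlinarith [sq_nonneg (2 * (∑ i ∈ Finset.range n, ξ i ω) -
      partialSups (fun k => ∑ i ∈ Finset.range k, ξ i ω) n)]
  calc _ ≤ ∫ ω, (4 * (∑ i ∈ Finset.range n, ξ i ω) ^ 2 - 4 * ∑ k ∈ Finset.range n,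
        partialSups (fun k => ∑ i ∈ Finset.range k, ξ i ω) k * ξ k ω) ∂P :=
        integral_mono hi1 ((hi2.const_mul 4).sub (hi3.const_mul 4)) hpath
    _ = _ := by
      rw [integral_sub (hi2.const_mul 4) (hi3.const_mul 4), integral_const_mul,
        integral_const_mul, integral_finsetSum _ fun k _ => hprod k]
      simp [hcross]

end Doob

/-! ### The running supremum along uniform grids -/

/-- The `k`-th point of the uniform subdivision of `[s, s + h]` into `N` intervals. -/
noncomputable def uniformGrid (s h : ℝ≥0) (N k : ℕ) : ℝ≥0 := s + k * (h / N)

lemma uniformGrid_zero (s h : ℝ≥0) (N : ℕ) : uniformGrid s h N 0 = s := by simp [uniformGrid]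

lemma uniformGrid_succ (s h : ℝ≥0) (N k : ℕ) :
    uniformGrid s h N (k + 1) = uniformGrid s h N k + h / N := by
  simp [uniformGrid]; ring

lemma monotone_uniformGrid (s h : ℝ≥0) (N : ℕ) : Monotone (uniformGrid s h N) :=
  monotone_nat_of_le_succ fun k => by rw [uniformGrid_succ]; exact le_self_add

lemma uniformGrid_self (s h : ℝ≥0) {N : ℕ} (hN : N ≠ 0) : uniformGrid s h N N = s + h := by
  have : (N : ℝ≥0) ≠ 0 := by exact_mod_cast hN
  rw [uniformGrid]; field_simp

/-- Along refining grids, a right-continuous function is approximated at every point from the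
grid values. -/
lemma exists_tendsto_uniformGrid {f : ℝ≥0 → ℝ} {s h u : ℝ≥0}
    (hf : ContinuousWithinAt f (Set.Ici u) u) (hsu : s ≤ u) (hus : u ≤ s + h) :
    ∃ k : ℕ → ℕ, (∀ N, k N ≤ N + 1) ∧
      Tendsto (fun N => f (uniformGrid s h (N + 1) (k N))) atTop (𝓝 (f u)) := by
  rcases eq_or_ne h 0 with rfl | hh
  · have : u = s := le_antisymm (by simpa using hus) hsu
    subst this
    exact ⟨fun _ => 0, fun _ => Nat.zero_le _, by simp [uniformGrid_zero]⟩
  obtain ⟨d, rfl⟩ := exists_add_of_le hsu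
  have hd : d ≤ h := by simpa using hus
  have hh0 : 0 < h := pos_iff_ne_zero.2 hh
  refine ⟨fun N => ⌈d * (N + 1 : ℕ) / h⌉₊, fun N => ?_, ?_⟩
  · rw [Nat.ceil_le, div_le_iff₀ hh0, mul_comm]
    gcongr
  · have hlow : ∀ N : ℕ, s + d ≤ uniformGrid s h (N + 1) ⌈d * (N + 1 : ℕ) / h⌉₊ := fun N => by
      rw [uniformGrid]
      gcongr
      have hN : (0 : ℝ≥0) < (N + 1 : ℕ) := by positivity
      calc d = d * (N + 1 : ℕ) / h * (h / (N + 1 : ℕ)) := by field_simp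
        _ ≤ _ := by gcongr; exact Nat.le_ceil _
    have hup : ∀ N : ℕ, uniformGrid s h (N + 1) ⌈d * (N + 1 : ℕ) / h⌉₊
        ≤ s + d + h / (N + 1 : ℕ) := fun N => by
      rw [uniformGrid, add_assoc]
      gcongr
      have hN : (0 : ℝ≥0) < (N + 1 : ℕ) := by positivity
      calc _ ≤ (d * (N + 1 : ℕ) / h + 1) * (h / (N + 1 : ℕ)) := by
            gcongr; exact (Nat.ceil_lt_add_one zero_le).le
        _ = _ := by field_simp
    have hlim : Tendsto (fun N : ℕ => s + d + h / (N + 1 : ℕ)) atTop (𝓝 (s + d)) := by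
      have h1 : Tendsto (fun N : ℕ => h / (N : ℝ≥0)) atTop (𝓝 0) := by
        rw [← NNReal.tendsto_coe]
        simpa using tendsto_const_div_atTop_nhds_zero_nat (h : ℝ)
      simpa using ((tendsto_add_atTop_iff_nat 1).2 h1).const_add (s + d)
    refine hf.tendsto.comp (tendsto_nhdsWithin_iff.2 ⟨?_, Eventually.of_forall hlow⟩)
    exact tendsto_of_tendsto_of_tendsto_of_le_of_le tendsto_const_nhds hlim hlow hup

/-- The largest displacement from the left end point, over the points of a uniform grid. -/
noncomputable def gridMax (f : ℝ≥0 → ℝ) (s h : ℝ≥0) (N : ℕ) : ℝ :=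
  partialSups (fun k => f (uniformGrid s h N k) - f s) N

lemma gridMax_nonneg (f : ℝ≥0 → ℝ) (s h : ℝ≥0) (N : ℕ) : 0 ≤ gridMax f s h N := by
  have := le_partialSups_of_le (fun k => f (uniformGrid s h N k) - f s) (Nat.zero_le N)
  simpa [gridMax, uniformGrid_zero] using this

/-- A function on `[0, ∞)` is càdlàg: right-continuous, with left limits. -/
def IsCadlag (f : ℝ≥0 → ℝ) : Prop :=
  ∀ t : ℝ≥0, ContinuousWithinAt f (Set.Ici t) t ∧ ∃ l : ℝ, Tendsto f (𝓝[<] t) (𝓝 l)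

lemma IsCadlag.bddAbove {f : ℝ≥0 → ℝ} (hf : IsCadlag f) (t : ℝ≥0) :
    BddAbove (f '' Set.Iic t) := by
  have hc : IsCompact (Set.Iic t) := by
    rw [← Set.Icc_bot]; exact isCompact_Icc
  refine hc.induction_on (p := fun s => BddAbove (f '' s)) (by simp)
    (fun s u hsu hu => hu.mono (Set.image_mono hsu))
    (fun s u hs hu => by rw [Set.image_union]; exact hs.union hu) fun x _ => ?_
  obtain ⟨hr, l, hl⟩ := hf x
  have h1 : ∀ᶠ y in 𝓝[≥] x, f y ≤ max (f x) l + 1 :=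
    (hr.tendsto.eventually_lt_const (lt_add_one _)).mono fun y hy =>
      hy.le.trans (by gcongr; exact le_max_left _ _)
  have h2 : ∀ᶠ y in 𝓝[<] x, f y ≤ max (f x) l + 1 :=
    (hl.eventually_lt_const (lt_add_one _)).mono fun y hy =>
      hy.le.trans (by gcongr; exact le_max_right _ _)
  have h3 : ∀ᶠ y in 𝓝 x, f y ≤ max (f x) l + 1 := by
    rw [← nhdsLT_sup_nhdsGE]
    exact eventually_sup.2 ⟨h2, h1⟩
  exact ⟨{y | f y ≤ max (f x) l + 1}, mem_nhdsWithin_of_mem_nhds h3, _,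
    by rintro _ ⟨y, hy, rfl⟩; exact hy⟩

lemma IsCadlag.bddAbove_range {f : ℝ≥0 → ℝ} (hf : IsCadlag f) (t : ℝ≥0) :
    BddAbove (Set.range fun s : Set.Iic t => f s) := by
  obtain ⟨b, hb⟩ := hf.bddAbove t
  exact ⟨b, by rintro _ ⟨s, rfl⟩; exact hb ⟨s, s.2, rfl⟩⟩

section runningSup

variable {Ω : Type*} {X : ℝ≥0 → Ω → ℝ} {ω : Ω}

lemma le_runningSup (hc : IsCadlag fun u => X u ω) {u t : ℝ≥0} (hu : u ≤ t) :
    X u ω ≤ runningSup X t ω :=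
  le_ciSup (hc.bddAbove_range t) (⟨u, hu⟩ : Set.Iic t)

lemma runningSup_le {t : ℝ≥0} {b : ℝ} (h : ∀ u ≤ t, X u ω ≤ b) : runningSup X t ω ≤ b :=
  have : Nonempty (Set.Iic t) := ⟨⟨t, Set.mem_Iic.2 le_rfl⟩⟩
  ciSup_le fun s => h s s.2

lemma runningSup_mono (hc : IsCadlag fun u => X u ω) {s t : ℝ≥0} (hst : s ≤ t) :
    runningSup X s ω ≤ runningSup X t ω :=
  runningSup_le fun _ hu => le_runningSup hc (hu.trans hst)

/-- An increment of the running supremum is at most the asymptotic grid maximum. -/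
lemma ofReal_runningSup_sub_le (hc : IsCadlag fun u => X u ω) (s h : ℝ≥0) :
    ENNReal.ofReal (runningSup X (s + h) ω - runningSup X s ω) ≤
      liminf (fun N : ℕ => ENNReal.ofReal (gridMax (fun u => X u ω) s h (N + 1))) atTop := by
  set W := liminf (fun N : ℕ => ENNReal.ofReal (gridMax (fun u => X u ω) s h (N + 1))) atTop
  have key : ∀ u, s ≤ u → u ≤ s + h → ENNReal.ofReal (X u ω - X s ω) ≤ W := by
    intro u hsu hus
    obtain ⟨k, hk, hlim⟩ := exists_tendsto_uniformGrid (hc u).1 hsu hus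
    have h1 := (ENNReal.continuous_ofReal.tendsto _).comp (hlim.sub_const (X s ω))
    rw [← h1.liminf_eq]
    refine liminf_le_liminf (Eventually.of_forall fun N => ENNReal.ofReal_le_ofReal ?_)
    exact le_partialSups_of_le
      (fun k => X (uniformGrid s h (N + 1) k) ω - X s ω) (hk N)
  rcases eq_or_ne W ∞ with hW | hW
  · rw [hW]; exact le_top
  · rw [ENNReal.ofReal_le_iff_le_toReal hW, sub_le_iff_le_add']
    refine runningSup_le fun u hu => ?_
    rcases le_total u s with hus | hsu
    · exact (le_runningSup hc hus).trans (le_add_of_nonneg_right ENNReal.toReal_nonneg)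
    · have := (ENNReal.ofReal_le_iff_le_toReal hW).1 (key u hsu hu)
      linarith [le_runningSup hc (le_refl s)]

/-- The running supremum of a càdlàg path is right-continuous. -/
lemma runningSup_continuousWithinAt (hc : IsCadlag fun u => X u ω) (t : ℝ≥0) :
    ContinuousWithinAt (fun u => runningSup X u ω) (Set.Ici t) t := by
  rw [Metric.continuousWithinAt_iff']
  intro ε hε
  have h1 : ∀ᶠ u in 𝓝[≥] t, X u ω < X t ω + ε / 2 :=
    (hc t).1.tendsto.eventually_lt_const (by linarith)
  obtain ⟨b, hb, hsub⟩ := mem_nhdsGE_iff_exists_Ico_subset.1 h1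
  filter_upwards [Ico_mem_nhdsGE hb] with u hu
  rw [Real.dist_eq, abs_of_nonneg (sub_nonneg.2 (runningSup_mono hc hu.1))]
  have : runningSup X u ω ≤ runningSup X t ω + ε / 2 := by
    refine runningSup_le fun r hr => ?_
    rcases le_total r t with hrt | htr
    · linarith [le_runningSup hc hrt]
    · have := hsub ⟨htr, hr.trans_lt hu.2⟩
      simp only [Set.mem_ofPred_eq] at this
      linarith [le_runningSup hc (le_refl t)]
  linarith

/-- The running supremum evaluated through countably many coordinates of the path, hence measurable
in the path; it agrees with `runningSup` on càdlàg paths. -/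
noncomputable def gridSup (f : ℝ≥0 → ℝ) (t : ℝ≥0) : ℝ :=
  ⨆ N : ℕ, partialSups (fun k => f (uniformGrid 0 t (N + 1) k)) (N + 1)

lemma measurable_gridSup (t : ℝ≥0) : Measurable fun f : ℝ≥0 → ℝ => gridSup f t :=
  Measurable.iSup fun N => measurable_partialSups_apply
    (S := fun k (f : ℝ≥0 → ℝ) => f (uniformGrid 0 t (N + 1) k)) _ fun _ _ => measurable_pi_apply _

lemma gridSup_eq_runningSup (hc : IsCadlag fun u => X u ω) (t : ℝ≥0) :
    gridSup (fun u => X u ω) t = runningSup X t ω := by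
  have hle : ∀ N : ℕ, partialSups (fun k => X (uniformGrid 0 t (N + 1) k) ω) (N + 1) ≤
      runningSup X t ω := fun N => partialSups_le _ _ _ fun k hk => le_runningSup hc <|
        (monotone_uniformGrid 0 t (N + 1) hk).trans
          (by rw [uniformGrid_self _ _ (Nat.succ_ne_zero N), zero_add])
  refine le_antisymm (ciSup_le hle) (runningSup_le fun u hu => ?_)
  obtain ⟨k, hk, hlim⟩ :=
    exists_tendsto_uniformGrid (s := 0) (h := t) (hc u).1 zero_le (by rwa [zero_add])
  refine le_of_tendsto' hlim fun N => ?_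
  exact (le_partialSups_of_le (fun k => X (uniformGrid 0 t (N + 1) k) ω) (hk N)).trans
    (le_ciSup (f := fun N : ℕ => partialSups (fun k => X (uniformGrid 0 t (N + 1) k) ω) (N + 1))
      ⟨_, by rintro _ ⟨N, rfl⟩; exact hle N⟩ N)

/-- Moments of an increment of the running supremum are controlled by those of grid maxima. -/
lemma lintegral_runningSup_sub_pow_le [MeasurableSpace Ω] {P : Measure Ω}
    (hX : ∀ t, Measurable (X t)) (hc : ∀ᵐ ω ∂P, IsCadlag fun u => X u ω) (s h : ℝ≥0) (p : ℕ)
    {B : ℝ≥0∞} (hB : ∀ N : ℕ,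
      ∫⁻ ω, ENNReal.ofReal (gridMax (fun u => X u ω) s h (N + 1)) ^ p ∂P ≤ B) :
    ∫⁻ ω, ENNReal.ofReal (runningSup X (s + h) ω - runningSup X s ω) ^ p ∂P ≤ B := by
  calc _ ≤ ∫⁻ ω, liminf (fun N : ℕ =>
          ENNReal.ofReal (gridMax (fun u => X u ω) s h (N + 1)) ^ p) atTop ∂P := by
        refine lintegral_mono_ae (hc.mono fun ω hω => ?_)
        refine (pow_le_pow_left' (ofReal_runningSup_sub_le hω s h) p).trans (le_of_eq ?_)
        exact Monotone.map_liminf_of_continuousAt (f := fun x : ℝ≥0∞ => x ^ p)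
          (fun _ _ hxy => pow_le_pow_left' hxy p) _ (ENNReal.continuous_pow p).continuousAt
    _ ≤ liminf (fun N : ℕ => ∫⁻ ω,
          ENNReal.ofReal (gridMax (fun u => X u ω) s h (N + 1)) ^ p ∂P) atTop := by
        refine lintegral_liminf_le fun N => ?_
        exact (measurable_partialSups_apply
          (S := fun k ω => X (uniformGrid s h (N + 1) k) ω - X s ω) _
            fun _ _ => (hX _).sub (hX _)).ennreal_ofReal.pow_const p
    _ ≤ B := liminf_le_of_le (by isBoundedDefault) fun b hb => by
        obtain ⟨N, hN⟩ := hb.exists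
        exact hN.trans (hB N)

end runningSup

/-! ### Moment bounds for increments -/

/-- `X_h` is square integrable with mean `κ h` and variance `v h`, for every `h`. -/
structure HasLinearMoments {Ω : Type*} [MeasurableSpace Ω] (X : ℝ≥0 → Ω → ℝ) (P : Measure Ω)
    (κ v : ℝ) : Prop where
  memLp : ∀ h : ℝ≥0, MemLp (fun ω => X h ω - κ * h) 2 P
  mean : ∀ h : ℝ≥0, ∫ ω, (X h ω - κ * h) ∂P = 0
  var : ∀ h : ℝ≥0, ∫ ω, (X h ω - κ * h) ^ 2 ∂P = v * h

namespace IsLevyProcess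

variable {Ω : Type*} [MeasurableSpace Ω] {P : Measure Ω} {X : ℝ≥0 → Ω → ℝ} {κ v : ℝ}

lemma identDistrib_sub (hL : IsLevyProcess X P) (c : ℝ) (s h : ℝ≥0) :
    IdentDistrib (fun ω => X (s + h) ω - X s ω - c) (fun ω => X h ω - c) P P :=
  (hL.stationary_increments s h).comp (measurable_id.sub_const c)

lemma measurable_enorm_incr (hL : IsLevyProcess X P) (s u : ℝ≥0) :
    Measurable fun ω => ‖X u ω - X s ω‖ₑ :=
  ((hL.measurable u).sub (hL.measurable s)).enorm

lemma lintegral_enorm_incr (hL : IsLevyProcess X P) (s h : ℝ≥0) :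
    ∫⁻ ω, ‖X (s + h) ω - X s ω‖ₑ ∂P = ∫⁻ ω, ‖X h ω‖ₑ ∂P :=
  ((hL.stationary_increments s h).comp measurable_enorm).lintegral_eq

lemma memLp_incr (hL : IsLevyProcess X P) (hM : HasLinearMoments X P κ v) (s h : ℝ≥0) :
    MemLp (fun ω => X (s + h) ω - X s ω - κ * h) 2 P :=
  (hL.identDistrib_sub _ s h).memLp_iff.2 (hM.memLp h)

lemma integral_incr (hL : IsLevyProcess X P) (hM : HasLinearMoments X P κ v) (s h : ℝ≥0) :
    ∫ ω, (X (s + h) ω - X s ω - κ * h) ∂P = 0 :=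
  (hL.identDistrib_sub _ s h).integral_eq.trans (hM.mean h)

lemma integral_incr_sq (hL : IsLevyProcess X P) (hM : HasLinearMoments X P κ v) (s h : ℝ≥0) :
    ∫ ω, (X (s + h) ω - X s ω - κ * h) ^ 2 ∂P = v * h :=
  ((hL.identDistrib_sub _ s h).comp (measurable_id.pow_const 2)).integral_eq.trans (hM.var h)

lemma memLp_increment [IsProbabilityMeasure P] (hL : IsLevyProcess X P)
    (hM : HasLinearMoments X P κ v) (s h : ℝ≥0) :
    MemLp (fun ω => X (s + h) ω - X s ω) 2 P := by
  refine ((hL.memLp_incr hM s h).add (memLp_const (κ * h))).congr_norm ?_ (ae_of_all _ fun ω => ?_)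
  · exact ((hL.measurable _).sub (hL.measurable _)).aestronglyMeasurable
  · simp

lemma integral_increment_sq [IsProbabilityMeasure P] (hL : IsLevyProcess X P)
    (hM : HasLinearMoments X P κ v)
    (s h : ℝ≥0) :
    ∫ ω, (X (s + h) ω - X s ω) ^ 2 ∂P = v * h + κ ^ 2 * h ^ 2 := by
  have h1 := hL.memLp_incr hM s h
  have hi1 := h1.integrable_sq
  have hi2 := (h1.integrable one_le_two).const_mul (2 * κ * h)
  have hi12 : Integrable (fun ω => (X (s + h) ω - X s ω - κ * h) ^ 2 +
      2 * κ * h * (X (s + h) ω - X s ω - κ * h)) P := hi1.add hi2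
  have : ∀ ω, (X (s + h) ω - X s ω) ^ 2 = (X (s + h) ω - X s ω - κ * h) ^ 2 +
      2 * κ * h * (X (s + h) ω - X s ω - κ * h) + κ ^ 2 * h ^ 2 := fun ω => by ring
  simp_rw [this]
  rw [integral_add hi12 (integrable_const _), integral_add hi1 hi2, integral_const_mul,
    hL.integral_incr hM, hL.integral_incr_sq hM]
  simp

lemma lintegral_increment_sq [IsProbabilityMeasure P] (hL : IsLevyProcess X P)
    (hM : HasLinearMoments X P κ v)
    (s h : ℝ≥0) :
    ∫⁻ ω, ENNReal.ofReal ((X (s + h) ω - X s ω) ^ 2) ∂P =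
      ENNReal.ofReal (v * h + κ ^ 2 * h ^ 2) := by
  rw [← hL.integral_increment_sq hM, ofReal_integral_eq_lintegral_ofReal
    (hL.memLp_increment hM s h).integrable_sq (ae_of_all _ fun _ => sq_nonneg _)]

/-- Doob's inequality for the centred increments over a grid; the drift adds at most `|κ| h`. -/
lemma lintegral_gridMax_sq_le [IsProbabilityMeasure P] (hL : IsLevyProcess X P)
    (hM : HasLinearMoments X P κ v)
    (s h : ℝ≥0) (N : ℕ) :
    ∫⁻ ω, ENNReal.ofReal (gridMax (fun u => X u ω) s h (N + 1)) ^ 2 ∂P ≤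
      ENNReal.ofReal (8 * v * h + 2 * κ ^ 2 * h ^ 2) := by
  set g := uniformGrid s h (N + 1) with hg
  set δ : ℝ≥0 := h / (N + 1 : ℕ) with hδ
  set ξ : ℕ → Ω → ℝ := fun k ω => X (g (k + 1)) ω - X (g k) ω - κ * δ with hξ
  have hsucc : ∀ k, g (k + 1) = g k + δ := fun k => uniformGrid_succ _ _ _ _
  have hg0 : g 0 = s := uniformGrid_zero _ _ _
  have hgN : g (N + 1) = s + h := uniformGrid_self _ _ N.succ_ne_zero
  have hm : ∀ i, Measurable (ξ i) := fun i =>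
    ((hL.measurable _).sub (hL.measurable _)).sub_const _
  have hind : iIndepFun ξ P :=
    (hL.indep_increments.nat (monotone_uniformGrid s h (N + 1))).comp
      (fun _ x => x - κ * δ) fun _ => measurable_id.sub_const _
  have hmem : ∀ i, MemLp (ξ i) 2 P := fun i => by
    simp only [hξ, hsucc]; exact hL.memLp_incr hM _ _
  have hmean : ∀ i, ∫ ω, ξ i ω ∂P = 0 := fun i => by
    simp only [hξ, hsucc]; exact hL.integral_incr hM _ _
  have hsum : ∀ k ω, ∑ i ∈ Finset.range k, ξ i ω = X (g k) ω - X s ω - κ * (k * δ) := by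
    intro k ω
    simp only [hξ]
    rw [Finset.sum_sub_distrib, Finset.sum_range_sub (fun k => X (g k) ω), hg0]
    simp; ring
  have hNδ : ((N + 1 : ℕ) : ℝ) * δ = h := by
    rw [hδ]; push_cast; field_simp
  have hdoob := integral_partialSups_sum_sq_le hm hind hmem hmean (N + 1)
  have hlast : ∫ ω, (∑ i ∈ Finset.range (N + 1), ξ i ω) ^ 2 ∂P = v * h := by
    simp_rw [hsum, hNδ, hgN]
    exact hL.integral_incr_sq hM s h
  rw [hlast] at hdoob
  set M : Ω → ℝ := fun ω => partialSups (fun k => ∑ i ∈ Finset.range k, ξ i ω) (N + 1) with hMdef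
  have hMmem : MemLp M 2 P := memLp_partialSups_apply
    (S := fun k ω => ∑ i ∈ Finset.range k, ξ i ω)
    (fun k => memLp_finsetSum _ fun i _ => hmem i) _
  have hpath : ∀ ω, gridMax (fun u => X u ω) s h (N + 1) ^ 2 ≤
      2 * M ω ^ 2 + 2 * κ ^ 2 * h ^ 2 := fun ω => by
    have h1 : gridMax (fun u => X u ω) s h (N + 1) ≤ M ω + |κ| * h := by
      refine partialSups_le _ _ _ fun k hk => ?_
      have h2 : X (g k) ω - X s ω - κ * (k * δ) ≤ M ω := by
        rw [← hsum]
        exact le_partialSups_of_le (fun k => ∑ i ∈ Finset.range k, ξ i ω) hk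
      have h3 : κ * (k * δ) ≤ |κ| * h := by
        refine (le_abs_self _).trans ?_
        rw [abs_mul]
        gcongr
        rw [abs_of_nonneg (by positivity), ← hNδ]
        gcongr
      simp only [← hg]
      linarith
    have h0 := gridMax_nonneg (fun u => X u ω) s h (N + 1)
    calc _ ≤ (M ω + |κ| * h) ^ 2 := by gcongr
      _ ≤ 2 * M ω ^ 2 + 2 * (|κ| * h) ^ 2 := by nlinarith [sq_nonneg (M ω - |κ| * h)]
      _ = _ := by rw [mul_pow, sq_abs]; ring
  have hint : Integrable (fun ω => 2 * M ω ^ 2 + 2 * κ ^ 2 * h ^ 2) P :=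
    (hMmem.integrable_sq.const_mul 2).add (integrable_const _)
  calc _ ≤ ∫⁻ ω, ENNReal.ofReal (2 * M ω ^ 2 + 2 * κ ^ 2 * h ^ 2) ∂P := by
        refine lintegral_mono fun ω => ?_
        rw [← ENNReal.ofReal_pow (gridMax_nonneg _ _ _ _)]
        exact ENNReal.ofReal_le_ofReal (hpath ω)
    _ = ENNReal.ofReal (∫ ω, (2 * M ω ^ 2 + 2 * κ ^ 2 * h ^ 2) ∂P) :=
        (ofReal_integral_eq_lintegral_ofReal hint (ae_of_all _ fun _ => by positivity)).symm
    _ ≤ _ := by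
        refine ENNReal.ofReal_le_ofReal ?_
        rw [integral_add (hMmem.integrable_sq.const_mul 2) (integrable_const _),
          integral_const_mul]
        simp
        linarith

lemma lintegral_runningSup_sub_sq_le [IsProbabilityMeasure P] (hL : IsLevyProcess X P)
    (hM : HasLinearMoments X P κ v)
    (s h : ℝ≥0) :
    ∫⁻ ω, ENNReal.ofReal (runningSup X (s + h) ω - runningSup X s ω) ^ 2 ∂P ≤
      ENNReal.ofReal (8 * v * h + 2 * κ ^ 2 * h ^ 2) :=
  lintegral_runningSup_sub_pow_le hL.measurable hL.cadlag s h 2 (hL.lintegral_gridMax_sq_le hM s h)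

/-- Paths of bounded variation force `E|X_{1/N}| = O(1/N)`: the sums `S_N = ∑ |ΔX|` over the
uniform grids of `[0, 1]` are bounded in `N` almost surely, while their variances are bounded
by `v + κ²`, so Chebyshev's inequality bounds their means. -/
lemma exists_lintegral_enorm_le [IsProbabilityMeasure P] (hL : IsLevyProcess X P)
    (hM : HasLinearMoments X P κ v)
    (hv : 0 ≤ v) (hBV : HasBoundedVariationPaths X P) :
    ∃ C : ℝ, 0 < C ∧ ∀ N : ℕ,
      ∫⁻ ω, ‖X (1 / (N + 1 : ℕ)) ω‖ₑ ∂P ≤ ENNReal.ofReal (C / (N + 1 : ℕ)) := by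
  set g : ℕ → ℕ → ℝ≥0 := fun N => uniformGrid 0 1 (N + 1) with hg
  set S : ℕ → Ω → ℝ := fun N ω =>
    ∑ k ∈ Finset.range (N + 1), |X (g N (k + 1)) ω - X (g N k) ω| with hS
  have hsucc : ∀ N k, g N (k + 1) = g N k + 1 / (N + 1 : ℕ) := fun N k => uniformGrid_succ _ _ _ _
  have hS0 : ∀ N ω, 0 ≤ S N ω := fun N ω => Finset.sum_nonneg fun _ _ => abs_nonneg _
  -- almost surely the sums stay below the total variation of the path
  have hfin : ∀ᵐ ω ∂P, ∃ n : ℕ, ∀ N, S N ω ≤ n := by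
    filter_upwards [hBV] with ω hω
    have hV : eVariationOn (fun s => X s ω) (Set.univ ∩ Set.Icc 0 1) ≠ ∞ :=
      hω 0 1 (Set.mem_univ _) (Set.mem_univ _)
    obtain ⟨n, hn⟩ := exists_nat_ge
      (eVariationOn (fun s => X s ω) (Set.univ ∩ Set.Icc 0 1)).toReal
    refine ⟨n, fun N => le_trans ?_ hn⟩
    rw [← ENNReal.ofReal_le_iff_le_toReal hV]
    have hle := eVariationOn.sum_le_of_monotoneOn_Icc (f := fun s => X s ω)
      (s := Set.univ ∩ Set.Icc 0 1) (m := 0) (n := N + 1) (u := g N)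
      ((monotone_uniformGrid 0 1 (N + 1)).monotoneOn _) (fun i hi => ⟨Set.mem_univ _, zero_le, by
        refine (monotone_uniformGrid 0 1 (N + 1) hi.2).trans ?_
        rw [uniformGrid_self _ _ N.succ_ne_zero, zero_add]⟩)
    refine le_trans (le_of_eq ?_) hle
    rw [ENNReal.ofReal_sum_of_nonneg fun _ _ => abs_nonneg _, Nat.Ico_zero_eq_range]
    refine Finset.sum_congr rfl fun k _ => ?_
    rw [edist_dist, Real.dist_eq]
  obtain ⟨n, hn⟩ : ∃ n : ℕ, (1 / 2 : ℝ≥0∞) < P {ω | ∀ N, S N ω ≤ n} := by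
    have hmono : Monotone fun n : ℕ => {ω | ∀ N, S N ω ≤ n} := fun a b hab ω hω N =>
      (hω N).trans (by exact_mod_cast hab)
    have ht := tendsto_measure_iUnion_atTop (μ := P) hmono
    have hone : P (⋃ n : ℕ, {ω | ∀ N, S N ω ≤ n}) = 1 := by
      rw [measure_congr (eventuallyEq_univ.2 ?_), measure_univ]
      exact hfin.mono fun ω hω => Set.mem_iUnion.2 hω
    rw [hone] at ht
    exact (ht.eventually_const_lt (by norm_num)).exists
  have hmemabs : ∀ N k, MemLp (fun ω => |X (g N (k + 1)) ω - X (g N k) ω|) 2 P := fun N k => by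
    rw [hsucc]; exact (hL.memLp_increment hM _ _).abs
  have hSmem : ∀ N, MemLp (S N) 2 P := fun N => memLp_finsetSum _ fun k _ => hmemabs N k
  have hvar : ∀ N, variance (S N) P ≤ v + κ ^ 2 := fun N => by
    have hind : iIndepFun (fun k ω => |X (g N (k + 1)) ω - X (g N k) ω|) P :=
      (hL.indep_increments.nat (monotone_uniformGrid 0 1 (N + 1))).comp
        (fun _ x => |x|) fun _ => measurable_id.abs
    have hSeq : S N = ∑ k ∈ Finset.range (N + 1),
        fun ω => |X (g N (k + 1)) ω - X (g N k) ω| := by ext ω; simp [hS]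
    rw [hSeq, IndepFun.variance_sum (fun k _ => hmemabs N k)
      (fun i _ j _ hij => hind.indepFun hij)]
    have hterm : ∀ k, variance (fun ω => |X (g N (k + 1)) ω - X (g N k) ω|) P ≤
        (v + κ ^ 2) / (N + 1 : ℕ) := fun k => by
      refine (variance_le_expectation_sq (hmemabs N k).aestronglyMeasurable).trans ?_
      simp only [Pi.pow_apply, sq_abs, hsucc]
      rw [hL.integral_increment_sq hM]
      push_cast
      rw [add_div]
      have h1 : (1 : ℝ) ≤ (N : ℝ) + 1 := by linarith [(Nat.cast_nonneg N : (0 : ℝ) ≤ N)]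
      refine add_le_add (le_of_eq (by ring)) ?_
      rw [div_eq_mul_one_div (κ ^ 2)]
      gcongr
      refine pow_le_of_le_one (by positivity) ?_ two_ne_zero
      rw [div_le_one (by positivity)]
      exact h1
    refine (Finset.sum_le_card_nsmul _ _ _ fun k _ => hterm k).trans (le_of_eq ?_)
    simp
    field_simp
  -- a mean above `n + c` would make the event `S N ≤ n` a deviation of size `c`, whose probability
  -- is at most `(v + κ²) / c² < 1 / 2`
  set c : ℝ := 2 * Real.sqrt (v + κ ^ 2 + 1) with hc
  have hcpos : 0 < c := by positivity
  have hc2 : c ^ 2 = 4 * (v + κ ^ 2 + 1) := by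
    rw [hc, mul_pow, Real.sq_sqrt (by positivity)]; ring
  have hmean : ∀ N, ∫ ω, S N ω ∂P ≤ n + c := fun N => by
    by_contra! hcon
    have hcheb := meas_ge_le_variance_div_sq (hSmem N) hcpos
    have hsub : {ω | ∀ N, S N ω ≤ n} ⊆ {ω | c ≤ |S N ω - ∫ ω, S N ω ∂P|} := fun ω hω => by
      have h1 : S N ω ≤ n := hω N
      simp only [Set.mem_ofPred_eq]
      rw [abs_sub_comm]
      exact le_trans (by linarith) (le_abs_self _)
    have h2 : ENNReal.ofReal (variance (S N) P / c ^ 2) ≤ 1 / 2 := by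
      rw [← ENNReal.ofReal_one, ← ENNReal.ofReal_ofNat 2, ← ENNReal.ofReal_div_of_pos two_pos]
      refine ENNReal.ofReal_le_ofReal ?_
      rw [hc2, div_le_div_iff₀ (by positivity) two_pos]
      have := hvar N
      nlinarith [sq_nonneg κ]
    exact absurd (hn.trans_le ((measure_mono hsub).trans (hcheb.trans h2))) (lt_irrefl _)
  refine ⟨n + c, by positivity, fun N => ?_⟩
  have hNpos : (0 : ℝ) < (N + 1 : ℕ) := by positivity
  have hsumE : ((N + 1 : ℕ) : ℝ≥0∞) * ∫⁻ ω, ‖X (1 / (N + 1 : ℕ)) ω‖ₑ ∂P =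
      ENNReal.ofReal (∫ ω, S N ω ∂P) := by
    rw [ofReal_integral_eq_lintegral_ofReal ((hSmem N).integrable one_le_two)
      (ae_of_all _ (hS0 N))]
    simp only [hS]
    simp_rw [ENNReal.ofReal_sum_of_nonneg fun _ _ => abs_nonneg _, ← Real.enorm_eq_ofReal_abs,
      hsucc]
    rw [lintegral_finsetSum _ fun k _ => hL.measurable_enorm_incr _ _]
    simp_rw [hL.lintegral_enorm_incr]
    simp
  rw [ENNReal.ofReal_div_of_pos hNpos, ENNReal.ofReal_natCast,
    ENNReal.le_div_iff_mul_le (by simp) (by simp), mul_comm, hsumE]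
  exact ENNReal.ofReal_le_ofReal (hmean N)

/-- A bound `E|X_{1/N}| ≤ C / N` along the integers propagates to all times. -/
lemma lintegral_enorm_le (hL : IsLevyProcess X P) {C : ℝ}
    (hC : ∀ N : ℕ, ∫⁻ ω, ‖X (1 / (N + 1 : ℕ)) ω‖ₑ ∂P ≤ ENNReal.ofReal (C / (N + 1 : ℕ)))
    (h : ℝ≥0) :
    ∫⁻ ω, ‖X h ω‖ₑ ∂P ≤ ENNReal.ofReal (C * h) := by
  have hmul : ∀ (d : ℝ≥0) (k : ℕ), ∫⁻ ω, ‖X (k * d) ω‖ₑ ∂P ≤ k * ∫⁻ ω, ‖X d ω‖ₑ ∂P := by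
    intro d k
    induction k with
    | zero =>
      have : ∫⁻ ω, ‖X (((0 : ℕ) : ℝ≥0) * d) ω‖ₑ ∂P = 0 := by
        rw [lintegral_eq_zero_iff (hL.measurable _).enorm]
        filter_upwards [hL.zero] with ω hω
        simp [hω]
      rw [this]; exact zero_le
    | succ k ih =>
      have hk : ((k + 1 : ℕ) : ℝ≥0) * d = k * d + d := by push_cast; ring
      calc _ ≤ ∫⁻ ω, (‖X (k * d + d) ω - X (k * d) ω‖ₑ + ‖X (k * d) ω‖ₑ) ∂P := by
            rw [hk]
            refine lintegral_mono fun ω => ?_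
            simpa using enorm_add_le (X (k * d + d) ω - X (k * d) ω) (X (k * d) ω)
        _ = ∫⁻ ω, ‖X d ω‖ₑ ∂P + ∫⁻ ω, ‖X (k * d) ω‖ₑ ∂P := by
            rw [lintegral_add_right _ (hL.measurable _).enorm, hL.lintegral_enorm_incr]
        _ ≤ _ := by
            push_cast
            rw [add_mul, one_mul, add_comm]
            gcongr
  set q : ℕ → ℝ≥0 := fun N => (⌈h * (N + 1 : ℕ)⌉₊ : ℝ≥0) * (1 / (N + 1 : ℕ)) with hq
  have hlow : ∀ N, h ≤ q N := fun N => by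
    have hN : (0 : ℝ≥0) < (N + 1 : ℕ) := by positivity
    calc h = h * (N + 1 : ℕ) * (1 / (N + 1 : ℕ)) := by field_simp
      _ ≤ _ := by simp only [hq]; gcongr; exact Nat.le_ceil _
  have hup : ∀ N, q N ≤ h + 1 / (N + 1 : ℕ) := fun N => by
    have hN : (0 : ℝ≥0) < (N + 1 : ℕ) := by positivity
    calc q N ≤ (h * (N + 1 : ℕ) + 1) * (1 / (N + 1 : ℕ)) := by
          simp only [hq]; gcongr; exact (Nat.ceil_lt_add_one zero_le).le
      _ = _ := by field_simp
  have hlim0 : Tendsto (fun N : ℕ => h + 1 / (N + 1 : ℕ)) atTop (𝓝 h) := by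
    have h1 : Tendsto (fun N : ℕ => (1 : ℝ≥0) / (N : ℝ≥0)) atTop (𝓝 0) :=
      tendsto_const_div_atTop_nhds_zero_nat 1
    simpa using ((tendsto_add_atTop_iff_nat 1).2 h1).const_add h
  have hqlim : Tendsto q atTop (𝓝[≥] h) := tendsto_nhdsWithin_iff.2
    ⟨tendsto_of_tendsto_of_tendsto_of_le_of_le tendsto_const_nhds hlim0 hlow hup,
      Eventually.of_forall hlow⟩
  have hbound : ∀ N, ∫⁻ ω, ‖X (q N) ω‖ₑ ∂P ≤ ENNReal.ofReal (C * q N) := fun N => by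
    refine (hmul _ _).trans ((mul_le_mul_right (hC N) _).trans (le_of_eq ?_))
    rw [← ENNReal.ofReal_natCast, ← ENNReal.ofReal_mul (by positivity)]
    congr 1
    simp only [hq]
    push_cast
    ring
  calc _ ≤ ∫⁻ ω, liminf (fun N => ‖X (q N) ω‖ₑ) atTop ∂P := by
        refine lintegral_mono_ae (hL.cadlag.mono fun ω hω => ?_)
        have h1 := (continuous_enorm.tendsto _).comp ((hω h).1.tendsto.comp hqlim)
        exact h1.liminf_eq.symm.le
    _ ≤ liminf (fun N => ∫⁻ ω, ‖X (q N) ω‖ₑ ∂P) atTop :=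
        lintegral_liminf_le fun N => (hL.measurable _).enorm
    _ ≤ liminf (fun N => ENNReal.ofReal (C * q N)) atTop :=
        liminf_le_liminf (Eventually.of_forall hbound)
    _ = _ := by
        have h2 : Tendsto (fun N => ((q N : ℝ≥0) : ℝ)) atTop (𝓝 h) :=
          (NNReal.continuous_coe.tendsto h).comp (hqlim.mono_right nhdsWithin_le_nhds)
        exact ((ENNReal.continuous_ofReal.tendsto _).comp (h2.const_mul C)).liminf_eq

/-- An increment of the running supremum is dominated by the sum of `|ΔX|` over a grid. -/
lemma lintegral_runningSup_sub_le (hL : IsLevyProcess X P) {C : ℝ}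
    (hC : ∀ h : ℝ≥0, ∫⁻ ω, ‖X h ω‖ₑ ∂P ≤ ENNReal.ofReal (C * h)) (s h : ℝ≥0) :
    ∫⁻ ω, ENNReal.ofReal (runningSup X (s + h) ω - runningSup X s ω) ∂P ≤
      ENNReal.ofReal (C * h) := by
  have key := lintegral_runningSup_sub_pow_le hL.measurable hL.cadlag s h 1
    (B := ENNReal.ofReal (C * h)) fun N => ?_
  · simpa using key
  set g := uniformGrid s h (N + 1) with hg
  have hsucc : ∀ k, g (k + 1) = g k + h / (N + 1 : ℕ) := fun k => uniformGrid_succ _ _ _ _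
  have hpath : ∀ ω, ENNReal.ofReal (gridMax (fun u => X u ω) s h (N + 1)) ≤
      ∑ k ∈ Finset.range (N + 1), ‖X (g (k + 1)) ω - X (g k) ω‖ₑ := fun ω => by
    simp_rw [Real.enorm_eq_ofReal_abs]
    rw [← ENNReal.ofReal_sum_of_nonneg fun _ _ => abs_nonneg _]
    refine ENNReal.ofReal_le_ofReal (partialSups_le _ _ _ fun k hk => ?_)
    have h1 := Finset.sum_range_sub (fun k => X (g k) ω) k
    rw [show g 0 = s from uniformGrid_zero s h (N + 1)] at h1
    simp only [← hg]
    rw [← h1]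
    refine (Finset.sum_le_sum fun i _ => le_abs_self _).trans ?_
    exact Finset.sum_le_sum_of_subset_of_nonneg
      (Finset.range_subset_range.2 hk) fun _ _ _ => abs_nonneg _
  simp only [pow_one]
  refine (lintegral_mono hpath).trans ?_
  rw [lintegral_finsetSum _ fun k _ => hL.measurable_enorm_incr _ _]
  simp_rw [hsucc, hL.lintegral_enorm_incr]
  simp only [Finset.sum_const, Finset.card_range, nsmul_eq_mul]
  refine (mul_le_mul_right (hC _) _).trans (le_of_eq ?_)
  rw [← ENNReal.ofReal_natCast, ← ENNReal.ofReal_mul (by positivity)]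
  congr 1
  push_cast
  field_simp

end IsLevyProcess

/-! ### Integrating out an independent random time -/

/-- The right limit at `s` of a function on `[0, ∞)`, read off along the points `⌈s k⌉ / k`: an
evaluation map that is jointly measurable in the time and the path. -/
noncomputable def rightEval (s : ℝ≥0) (y : ℝ≥0 → ℝ) : ℝ :=
  limsup (fun k : ℕ => y ((⌈s * (k + 1 : ℕ)⌉₊ : ℝ≥0) / (k + 1 : ℕ))) atTop

lemma measurable_rightEval : Measurable fun p : ℝ≥0 × (ℝ≥0 → ℝ) => rightEval p.1 p.2 := by
  refine Measurable.limsup fun k => ?_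
  have h1 : Measurable fun q : ℕ × (ℝ≥0 → ℝ) => q.2 ((q.1 : ℝ≥0) / (k + 1 : ℕ)) :=
    measurable_from_prod_countable_right fun m =>
      measurable_pi_apply ((m : ℝ≥0) / (k + 1 : ℕ))
  have h2 : Measurable fun p : ℝ≥0 × (ℝ≥0 → ℝ) => (⌈p.1 * (k + 1 : ℕ)⌉₊, p.2) :=
    (Nat.measurable_ceil.comp (measurable_fst.mul_const _)).prodMk measurable_snd
  exact h1.comp h2

lemma measurable_rightEval_left (s : ℝ≥0) : Measurable (rightEval s) :=
  Measurable.of_uncurry_left (f := rightEval) measurable_rightEval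

lemma rightEval_eq {y : ℝ≥0 → ℝ} {s : ℝ≥0} (hy : ContinuousWithinAt y (Set.Ici s) s) :
    rightEval s y = y s := by
  have hlow : ∀ k : ℕ, s ≤ (⌈s * (k + 1 : ℕ)⌉₊ : ℝ≥0) / (k + 1 : ℕ) := fun k => by
    rw [le_div_iff₀ (by positivity)]
    exact Nat.le_ceil _
  have hup : ∀ k : ℕ, (⌈s * (k + 1 : ℕ)⌉₊ : ℝ≥0) / (k + 1 : ℕ) ≤ s + 1 / (k + 1 : ℕ) := fun k => by
    rw [div_le_iff₀ (by positivity), add_mul, one_div_mul_cancel (by positivity)]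
    exact (Nat.ceil_lt_add_one zero_le).le
  have hlim : Tendsto (fun k : ℕ => s + 1 / ((k + 1 : ℕ) : ℝ≥0)) atTop (𝓝 s) := by
    have h1 : Tendsto (fun N : ℕ => (1 : ℝ≥0) / (N : ℝ≥0)) atTop (𝓝 0) :=
      tendsto_const_div_atTop_nhds_zero_nat 1
    simpa using ((tendsto_add_atTop_iff_nat 1).2 h1).const_add s
  refine (hy.tendsto.comp (tendsto_nhdsWithin_iff.2
    ⟨tendsto_of_tendsto_of_tendsto_of_le_of_le tendsto_const_nhds hlim hlow hup,
      Eventually.of_forall hlow⟩)).limsup_eq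

/-- Evaluating a right-continuous process at an independent random time: the random time can be
integrated out separately. -/
lemma lintegral_comp_independent_time {Ω : Type*} [MeasurableSpace Ω] {P : Measure Ω}
    [IsProbabilityMeasure P] {Y : ℝ≥0 → Ω → ℝ} {g : Ω → ℝ≥0} (hY : ∀ s, Measurable (Y s))
    (hg : AEMeasurable g P) (hind : IndepFun g (fun ω s => Y s ω) P)
    (hc : ∀ᵐ ω ∂P, ∀ s, ContinuousWithinAt (fun u => Y u ω) (Set.Ici s) s) :
    AEMeasurable (fun ω => Y (g ω) ω) P ∧ ∀ φ : ℝ → ℝ≥0∞, Measurable φ →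
      ∫⁻ ω, φ (Y (g ω) ω) ∂P = ∫⁻ ω, ∫⁻ ω', φ (Y (g ω) ω') ∂P ∂P := by
  have hpath : Measurable fun ω s => Y s ω := measurable_pi_iff.2 hY
  have hpair : AEMeasurable (fun ω => (g ω, fun s => Y s ω)) P := hg.prodMk hpath.aemeasurable
  have heq : ∀ᵐ ω ∂P, rightEval (g ω) (fun s => Y s ω) = Y (g ω) ω :=
    hc.mono fun ω hω => rightEval_eq (hω _)
  refine ⟨(measurable_rightEval.comp_aemeasurable hpair).congr heq, fun φ hφ => ?_⟩
  have hφm : Measurable fun p : ℝ≥0 × (ℝ≥0 → ℝ) => φ (rightEval p.1 p.2) :=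
    hφ.comp measurable_rightEval
  have : IsProbabilityMeasure (P.map fun ω s => Y s ω) :=
    Measure.isProbabilityMeasure_map hpath.aemeasurable
  calc ∫⁻ ω, φ (Y (g ω) ω) ∂P
      = ∫⁻ ω, φ (rightEval (g ω) fun s => Y s ω) ∂P :=
        lintegral_congr_ae (heq.mono fun ω hω => by simp only [hω])
    _ = ∫⁻ p, φ (rightEval p.1 p.2) ∂(P.map fun ω => (g ω, fun s => Y s ω)) :=
        (lintegral_map' hφm.aemeasurable hpair).symm
    _ = ∫⁻ p, φ (rightEval p.1 p.2) ∂((P.map g).prod (P.map fun ω s => Y s ω)) := by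
        rw [hind.map_prod_eq_prod_map_map hg hpath.aemeasurable]
    _ = ∫⁻ s, ∫⁻ y, φ (rightEval s y) ∂(P.map fun ω s => Y s ω) ∂(P.map g) :=
        lintegral_prod _ hφm.aemeasurable
    _ = ∫⁻ ω, ∫⁻ y, φ (rightEval (g ω) y) ∂(P.map fun ω s => Y s ω) ∂P :=
        lintegral_map' hφm.lintegral_prod_right'.aemeasurable hg
    _ = ∫⁻ ω, ∫⁻ ω', φ (Y (g ω) ω') ∂P ∂P := by
        refine lintegral_congr fun ω => ?_
        have hφω : Measurable fun y => φ (rightEval (g ω) y) :=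
          hφ.comp (measurable_rightEval_left (g ω))
        rw [lintegral_map hφω hpath]
        exact lintegral_congr_ae (hc.mono fun ω' hω' => by simp only [rightEval_eq (hω' _)])

/-- A bound for functionals of the increments over `[s, s + h]` in terms of `h` gives a bound for
any two times in terms of their distance. The relation `r` is `=` or `≤` in the applications. -/
lemma lintegral_symm_sub {Ω : Type*} [MeasurableSpace Ω] {P : Measure Ω} {Z : ℝ≥0 → Ω → ℝ}
    {φ : ℝ → ℝ≥0∞} {b : ℝ → ℝ≥0∞}
    {r : ℝ≥0∞ → ℝ≥0∞ → Prop}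
    (hφ : ∀ x, φ (-x) = φ x)
    (hb : ∀ s h : ℝ≥0, r (∫⁻ ω, φ (Z (s + h) ω - Z s ω) ∂P) (b h)) (s t : ℝ≥0) :
    r (∫⁻ ω, φ (Z s ω - Z t ω) ∂P) (b |(s : ℝ) - t|) := by
  rcases le_total t s with h | h
  · obtain ⟨d, rfl⟩ := exists_add_of_le h
    simpa using hb t d
  · obtain ⟨d, rfl⟩ := exists_add_of_le h
    have h1 := hb s d
    have h2 : ∀ ω, φ (Z s ω - Z (s + d) ω) = φ (Z (s + d) ω - Z s ω) := fun ω => by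
      rw [← hφ, neg_sub]
    simp_rw [h2]
    simpa using h1

namespace IsLevyProcess

variable {Ω : Type*} [MeasurableSpace Ω] {P : Measure Ω} [IsProbabilityMeasure P]
  {X : ℝ≥0 → Ω → ℝ} {κ v : ℝ} {g : Ω → ℝ≥0}

lemma lintegral_endpoint (hL : IsLevyProcess X P) (hg : AEMeasurable g P)
    (hind : IndepFun g (fun ω s => X s ω) P) (t : ℝ≥0) :
    AEMeasurable (fun ω => X (g ω) ω - X t ω) P ∧ ∀ φ : ℝ → ℝ≥0∞, Measurable φ →
      ∫⁻ ω, φ (X (g ω) ω - X t ω) ∂P = ∫⁻ ω, ∫⁻ ω', φ (X (g ω) ω' - X t ω') ∂P ∂P := by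
  have hm : Measurable fun (y : ℝ≥0 → ℝ) s => y s - y t :=
    measurable_pi_iff.2 fun s => (measurable_pi_apply s).sub (measurable_pi_apply t)
  exact lintegral_comp_independent_time (Y := fun s ω => X s ω - X t ω)
    (fun s => (hL.measurable s).sub (hL.measurable t)) hg (hind.comp measurable_id hm)
    (hL.cadlag.mono fun ω hω s => (hω s).1.sub continuousWithinAt_const)

/-- The running supremum is only almost surely a measurable function of the coordinates of the
path, so the random time is integrated out for its version `gridSup`. -/
lemma lintegral_runningSup (hL : IsLevyProcess X P) (hg : AEMeasurable g P)
    (hind : IndepFun g (fun ω s => X s ω) P) (t : ℝ≥0) :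
    AEMeasurable (fun ω => runningSup X (g ω) ω - runningSup X t ω) P ∧
      ∀ φ : ℝ → ℝ≥0∞, Measurable φ →
        ∫⁻ ω, φ (runningSup X (g ω) ω - runningSup X t ω) ∂P =
          ∫⁻ ω, ∫⁻ ω', φ (runningSup X (g ω) ω' - runningSup X t ω') ∂P ∂P := by
  set Z : ℝ≥0 → Ω → ℝ := fun s ω => gridSup (fun u => X u ω) s with hZ
  have hm : Measurable fun (y : ℝ≥0 → ℝ) s => gridSup y s - gridSup y t :=
    measurable_pi_iff.2 fun s => (measurable_gridSup s).sub (measurable_gridSup t)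
  have hpath : Measurable fun ω s => X s ω := measurable_pi_iff.2 hL.measurable
  have hZm : ∀ s, Measurable (Z s) := fun s => by
    have h := (measurable_gridSup s).comp hpath
    exact h
  have heq : ∀ᵐ ω ∂P, ∀ s, Z s ω = runningSup X s ω :=
    hL.cadlag.mono fun ω hω => gridSup_eq_runningSup hω
  have hZind : IndepFun g (fun ω s => Z s ω - Z t ω) P := hind.comp measurable_id hm
  have hZc : ∀ᵐ ω ∂P, ∀ s, ContinuousWithinAt (fun u => Z u ω - Z t ω) (Set.Ici s) s := by
    filter_upwards [hL.cadlag, heq] with ω hω hω' s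
    simp only [hω']
    exact (runningSup_continuousWithinAt hω s).sub continuousWithinAt_const
  clear_value Z
  obtain ⟨h1, h2⟩ := lintegral_comp_independent_time (Y := fun s ω => Z s ω - Z t ω)
    (fun s => (hZm s).sub (hZm t)) hg hZind hZc
  refine ⟨h1.congr (heq.mono fun ω hω => by simp only [hω]), fun φ hφ => ?_⟩
  have h3 : ∫⁻ ω, φ (runningSup X (g ω) ω - runningSup X t ω) ∂P =
      ∫⁻ ω, φ (Z (g ω) ω - Z t ω) ∂P :=
    lintegral_congr_ae (heq.mono fun ω hω => by simp only [hω])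
  rw [h3, h2 φ hφ]
  exact lintegral_congr fun ω => lintegral_congr_ae (heq.mono fun ω' hω' => by simp only [hω'])

lemma lintegral_endpoint_sq (hL : IsLevyProcess X P) (hM : HasLinearMoments X P κ v)
    (hg : AEMeasurable g P) (hind : IndepFun g (fun ω s => X s ω) P) (t : ℝ≥0) :
    ∫⁻ ω, ENNReal.ofReal ((X (g ω) ω - X t ω) ^ 2) ∂P =
      ∫⁻ ω, ENNReal.ofReal (v * |(g ω : ℝ) - t| + κ ^ 2 * |(g ω : ℝ) - t| ^ 2) ∂P := by
  rw [(hL.lintegral_endpoint hg hind t).2 (fun x => ENNReal.ofReal (x ^ 2)) (by fun_prop)]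
  exact lintegral_congr fun ω => lintegral_symm_sub (r := Eq)
    (b := fun h => ENNReal.ofReal (v * h + κ ^ 2 * h ^ 2))
    (φ := fun x => ENNReal.ofReal (x ^ 2)) (by simp) (hL.lintegral_increment_sq hM) _ _

lemma lintegral_runningSup_sq_le (hL : IsLevyProcess X P) (hM : HasLinearMoments X P κ v)
    (hg : AEMeasurable g P) (hind : IndepFun g (fun ω s => X s ω) P) (t : ℝ≥0) :
    ∫⁻ ω, ENNReal.ofReal ((runningSup X (g ω) ω - runningSup X t ω) ^ 2) ∂P ≤
      ∫⁻ ω, ENNReal.ofReal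
        (8 * v * |(g ω : ℝ) - t| + 2 * κ ^ 2 * |(g ω : ℝ) - t| ^ 2) ∂P := by
  rw [(hL.lintegral_runningSup hg hind t).2 (fun x => ENNReal.ofReal (x ^ 2)) (by fun_prop)]
  refine lintegral_mono fun ω => lintegral_symm_sub (r := (· ≤ ·))
    (b := fun h => ENNReal.ofReal (8 * v * h + 2 * κ ^ 2 * h ^ 2))
    (φ := fun x => ENNReal.ofReal (x ^ 2)) (by simp) (fun s h => ?_) _ _
  refine le_trans (lintegral_mono_ae ?_) (hL.lintegral_runningSup_sub_sq_le hM s h)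
  filter_upwards [hL.cadlag] with ω hω
  rw [← ENNReal.ofReal_pow (sub_nonneg.2 (runningSup_mono hω le_self_add))]

lemma lintegral_endpoint_abs_le (hL : IsLevyProcess X P) {C : ℝ}
    (hC : ∀ h : ℝ≥0, ∫⁻ ω, ‖X h ω‖ₑ ∂P ≤ ENNReal.ofReal (C * h))
    (hg : AEMeasurable g P) (hind : IndepFun g (fun ω s => X s ω) P) (t : ℝ≥0) :
    ∫⁻ ω, ‖X (g ω) ω - X t ω‖ₑ ∂P ≤ ∫⁻ ω, ENNReal.ofReal (C * |(g ω : ℝ) - t|) ∂P := by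
  rw [(hL.lintegral_endpoint hg hind t).2 (fun x => ‖x‖ₑ) (by fun_prop)]
  exact lintegral_mono fun ω => lintegral_symm_sub (r := (· ≤ ·))
    (b := fun h => ENNReal.ofReal (C * h)) (φ := fun x => ‖x‖ₑ) (by simp)
    (fun s h => (hL.lintegral_enorm_incr s h).trans_le (hC h)) _ _

lemma lintegral_runningSup_abs_le (hL : IsLevyProcess X P) {C : ℝ}
    (hC : ∀ h : ℝ≥0, ∫⁻ ω, ‖X h ω‖ₑ ∂P ≤ ENNReal.ofReal (C * h))
    (hg : AEMeasurable g P) (hind : IndepFun g (fun ω s => X s ω) P) (t : ℝ≥0) :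
    ∫⁻ ω, ‖runningSup X (g ω) ω - runningSup X t ω‖ₑ ∂P ≤
      ∫⁻ ω, ENNReal.ofReal (C * |(g ω : ℝ) - t|) ∂P := by
  rw [(hL.lintegral_runningSup hg hind t).2 (fun x => ‖x‖ₑ) (by fun_prop)]
  refine lintegral_mono fun ω => lintegral_symm_sub (r := (· ≤ ·))
    (b := fun h => ENNReal.ofReal (C * h)) (φ := fun x => ‖x‖ₑ) (by simp) (fun s h => ?_) _ _
  refine le_trans (lintegral_mono_ae ?_) (hL.lintegral_runningSup_sub_le hC s h)
  filter_upwards [hL.cadlag] with ω hω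
  rw [Real.enorm_eq_ofReal (sub_nonneg.2 (runningSup_mono hω le_self_add))]

end IsLevyProcess

/-! ### Central moments of the Gamma time -/

/-- Multiplication by `x ^ k` raises the shape parameter by `k`, up to a constant. -/
lemma gammaPDF_mul_pow {a r : ℝ} (ha : 0 < a) (hr : 0 < r) (k : ℕ) {x : ℝ} (hx : x ≠ 0) :
    gammaPDF a r x * ENNReal.ofReal (x ^ k) =
      ENNReal.ofReal (Real.Gamma (a + k) / (Real.Gamma a * r ^ k)) * gammaPDF (a + k) r x := by
  rcases lt_or_gt_of_ne hx with h | h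
  · rw [gammaPDF_of_neg h, gammaPDF_of_neg h]; simp
  · have h1 := Real.Gamma_pos_of_pos ha
    have h2 : 0 < Real.Gamma (a + k) := Real.Gamma_pos_of_pos (by positivity)
    rw [gammaPDF_of_nonneg h.le, gammaPDF_of_nonneg h.le, ← ENNReal.ofReal_mul (by positivity),
      ← ENNReal.ofReal_mul (by positivity)]
    congr 1
    rw [Real.rpow_add_natCast hr.ne', add_sub_right_comm, Real.rpow_add_natCast h.ne']
    field_simp

lemma lintegral_pow_gammaMeasure {a r : ℝ} (ha : 0 < a) (hr : 0 < r) (k : ℕ) :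
    ∫⁻ x, ENNReal.ofReal (x ^ k) ∂(gammaMeasure a r) =
      ENNReal.ofReal (Real.Gamma (a + k) / (Real.Gamma a * r ^ k)) := by
  have hm : ∀ b, Measurable (gammaPDF b r) := fun b =>
    (measurable_gammaPDFReal b r).ennreal_ofReal
  rw [gammaMeasure, lintegral_withDensity_eq_lintegral_mul _ (hm a) (by fun_prop)]
  have hne : ∀ᵐ x : ℝ, x ≠ 0 := by simp [ae_iff]
  simp only [Pi.mul_apply]
  rw [lintegral_congr_ae (hne.mono fun x hx => gammaPDF_mul_pow ha hr k hx),
    lintegral_const_mul _ (hm _), lintegral_gammaPDF_eq_one (by positivity) hr, mul_one]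

namespace IsGammaTime

variable {Ω : Type*} [MeasurableSpace Ω] {P : Measure Ω} {X : ℝ≥0 → Ω → ℝ} {g : Ω → ℝ≥0}
  {n : ℕ} {t : ℝ≥0}

lemma aemeasurable (hg : IsGammaTime g n t X P) : AEMeasurable g P := by
  have := hg.hasLaw.aemeasurable.real_toNNReal
  simpa using this

lemma integral_pow (hg : IsGammaTime g n t X P) (hn : 1 ≤ n) (ht : 0 < t) (k : ℕ) :
    Integrable (fun ω => (g ω : ℝ) ^ k) P ∧ ∫ ω, (g ω : ℝ) ^ k ∂P =
      Real.Gamma (n + k) / (Real.Gamma n * ((n : ℝ) / t) ^ k) := by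
  have hn' : (0 : ℝ) < n := by exact_mod_cast hn
  have ht' : (0 : ℝ) < t := by exact_mod_cast ht
  have hr : (0 : ℝ) < n / t := by positivity
  have hlint : ∫⁻ ω, ENNReal.ofReal ((g ω : ℝ) ^ k) ∂P =
      ENNReal.ofReal (Real.Gamma (n + k) / (Real.Gamma n * ((n : ℝ) / t) ^ k)) := by
    rw [← lintegral_pow_gammaMeasure hn' hr k]
    exact hg.hasLaw.lintegral_comp (f := fun x => ENNReal.ofReal (x ^ k)) (by fun_prop)
  have hm : AEStronglyMeasurable (fun ω => (g ω : ℝ) ^ k) P :=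
    (hg.hasLaw.aemeasurable.pow_const k).aestronglyMeasurable
  have hint : Integrable (fun ω => (g ω : ℝ) ^ k) P := by
    refine ⟨hm, ?_⟩
    rw [hasFiniteIntegral_iff_ofReal (ae_of_all _ fun ω => by positivity), hlint]
    exact ENNReal.ofReal_lt_top
  refine ⟨hint, ?_⟩
  rw [integral_eq_lintegral_of_nonneg_ae (ae_of_all _ fun ω => by positivity) hm, hlint,
    ENNReal.toReal_ofReal]
  have h1 := Real.Gamma_pos_of_pos hn'
  have h2 : 0 < Real.Gamma ((n : ℝ) + k) := Real.Gamma_pos_of_pos (by positivity)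
  positivity

variable [IsProbabilityMeasure P]

/-- The second and fourth central moments of the Gamma time. -/
lemma central_moments (hg : IsGammaTime g n t X P) (hn : 1 ≤ n) (ht : 0 < t) :
    Integrable (fun ω => ((g ω : ℝ) - t) ^ 2) P ∧
      ∫ ω, ((g ω : ℝ) - t) ^ 2 ∂P = (t : ℝ) ^ 2 / n ∧
      Integrable (fun ω => ((g ω : ℝ) - t) ^ 4) P ∧
      ∫ ω, ((g ω : ℝ) - t) ^ 4 ∂P = (t : ℝ) ^ 4 * (3 / n ^ 2 + 6 / n ^ 3) := by
  have hn' : (0 : ℝ) < n := by exact_mod_cast hn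
  have ht' : (0 : ℝ) < t := by exact_mod_cast ht
  have hG := Real.Gamma_pos_of_pos hn'
  have hG1 : Real.Gamma ((n : ℝ) + 1) = n * Real.Gamma n := Real.Gamma_add_one hn'.ne'
  have hG2 : Real.Gamma ((n : ℝ) + 2) = (n + 1) * (n * Real.Gamma n) := by
    rw [← hG1, ← Real.Gamma_add_one (by positivity)]; congr 1; ring
  have hG3 : Real.Gamma ((n : ℝ) + 3) = (n + 2) * ((n + 1) * (n * Real.Gamma n)) := by
    rw [← hG2, ← Real.Gamma_add_one (by positivity)]; congr 1; ring
  have hG4 : Real.Gamma ((n : ℝ) + 4) = (n + 3) * ((n + 2) * ((n + 1) * (n * Real.Gamma n))) := by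
    rw [← hG3, ← Real.Gamma_add_one (by positivity)]; congr 1; ring
  obtain ⟨i1, m1⟩ := hg.integral_pow hn ht 1
  obtain ⟨i2, m2⟩ := hg.integral_pow hn ht 2
  obtain ⟨i3, m3⟩ := hg.integral_pow hn ht 3
  obtain ⟨i4, m4⟩ := hg.integral_pow hn ht 4
  push_cast at m1 m2 m3 m4
  rw [hG1] at m1
  rw [hG2] at m2
  rw [hG3] at m3
  rw [hG4] at m4
  have e2 : ∀ ω, ((g ω : ℝ) - t) ^ 2 = (g ω : ℝ) ^ 2 + ((-2 * t) * (g ω : ℝ) ^ 1 + (t : ℝ) ^ 2) :=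
    fun ω => by ring
  have e4 : ∀ ω, ((g ω : ℝ) - t) ^ 4 = (g ω : ℝ) ^ 4 + ((-4 * t) * (g ω : ℝ) ^ 3 +
      ((6 * t ^ 2) * (g ω : ℝ) ^ 2 + ((-4 * t ^ 3) * (g ω : ℝ) ^ 1 + (t : ℝ) ^ 4))) :=
    fun ω => by ring
  have hc : ∀ c : ℝ, Integrable (fun _ : Ω => c) P := fun c => integrable_const c
  have hadd : ∀ {f h : Ω → ℝ}, Integrable f P → Integrable h P →
      Integrable (fun ω => f ω + h ω) P := fun hf hh => hf.add hh
  have j1 := hadd (i1.const_mul (-2 * (t : ℝ))) (hc (t ^ 2))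
  have j2 := hadd (i1.const_mul (-4 * (t : ℝ) ^ 3)) (hc (t ^ 4))
  have j3 := hadd (i2.const_mul (6 * (t : ℝ) ^ 2)) j2
  have j4 := hadd (i3.const_mul (-4 * (t : ℝ))) j3
  simp_rw [e2, e4]
  refine ⟨hadd i2 j1, ?_, hadd i4 j4, ?_⟩
  · rw [integral_add i2 j1, integral_add (i1.const_mul _) (hc _), integral_const_mul, m1, m2]
    simp
    field_simp
    ring
  · rw [integral_add i4 j4, integral_add (i3.const_mul _) j3, integral_add (i2.const_mul _) j2,
      integral_add (i1.const_mul _) (hc _), integral_const_mul, integral_const_mul,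
      integral_const_mul, m1, m2, m3, m4]
    simp
    field_simp
    ring

lemma integrable_abs (hg : IsGammaTime g n t X P) (hn : 1 ≤ n) (ht : 0 < t) :
    Integrable (fun ω => |(g ω : ℝ) - t|) P := by
  have := (hg.integral_pow hn ht 1).1
  simp only [pow_one] at this
  exact (this.sub (integrable_const (t : ℝ))).abs

lemma integral_abs_le (hg : IsGammaTime g n t X P) (hn : 1 ≤ n) (ht : 0 < t) {ρ : ℝ} (hρ : 0 < ρ)
    (hρn : ρ ^ 2 = 1 / n) : ∫ ω, |(g ω : ℝ) - t| ∂P ≤ t * ρ := by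
  obtain ⟨i2, m2, -, -⟩ := hg.central_moments hn ht
  have ht' : (0 : ℝ) < t := by exact_mod_cast ht
  have hpath : ∀ ω, |(g ω : ℝ) - t| ≤ (2 * (t * ρ))⁻¹ * ((g ω : ℝ) - t) ^ 2 + t * ρ / 2 := by
    intro ω
    rw [← sq_abs, inv_mul_eq_div, div_add_div _ _ (by positivity) two_ne_zero,
      le_div_iff₀ (by positivity)]
    nlinarith [sq_nonneg (|(g ω : ℝ) - t| - t * ρ)]
  calc _ ≤ ∫ ω, ((2 * (t * ρ))⁻¹ * ((g ω : ℝ) - t) ^ 2 + t * ρ / 2) ∂P :=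
        integral_mono (hg.integrable_abs hn ht)
          ((i2.const_mul _).add (integrable_const _)) hpath
    _ = _ := by
        rw [integral_add (i2.const_mul _) (integrable_const _), integral_const_mul, m2,
          div_eq_mul_one_div, ← hρn]
        simp
        field_simp
        ring

/-- Interpolating the second moment between the first and the fourth bounds the mean absolute
deviation of the Gamma time from below. -/
lemma le_integral_abs (hg : IsGammaTime g n t X P) (hn : 1 ≤ n) (ht : 0 < t) {ρ : ℝ} (hρ : 0 < ρ)
    (hρn : ρ ^ 2 = 1 / n) : t * ρ / 8 ≤ ∫ ω, |(g ω : ℝ) - t| ∂P := by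
  obtain ⟨i2, m2, i4, m4⟩ := hg.central_moments hn ht
  have ht' : (0 : ℝ) < t := by exact_mod_cast ht
  have hn' : (1 : ℝ) ≤ n := by exact_mod_cast hn
  -- `y² ≤ l |y| + y⁴ / l²` for every `l > 0`; with `l` six standard deviations, the fourth moment
  -- `≤ 9 (t ρ)⁴` costs only a quarter of the variance `(t ρ)²`
  set l : ℝ := 6 * (t * ρ) with hl
  have hl0 : 0 < l := by positivity
  have hpath : ∀ ω, ((g ω : ℝ) - t) ^ 2 ≤
      l * |(g ω : ℝ) - t| + (l ^ 2)⁻¹ * ((g ω : ℝ) - t) ^ 4 := by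
    intro ω
    set y := |(g ω : ℝ) - t| with hy
    have hy0 : 0 ≤ y := abs_nonneg _
    have e2 : ((g ω : ℝ) - t) ^ 2 = y ^ 2 := (sq_abs _).symm
    have e4 : ((g ω : ℝ) - t) ^ 4 = y ^ 4 := by rw [hy, Even.pow_abs (by decide)]
    rw [e2, e4]
    rcases le_total y l with h | h
    · have : 0 ≤ (l ^ 2)⁻¹ * y ^ 4 := by positivity
      nlinarith
    · have h1 : y ^ 2 ≤ (l ^ 2)⁻¹ * y ^ 4 := by
        rw [inv_mul_eq_div, le_div_iff₀ (by positivity)]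
        have : l ^ 2 ≤ y ^ 2 := by gcongr
        nlinarith [sq_nonneg y]
      have : 0 ≤ l * y := by positivity
      linarith
  have hi := hg.integrable_abs hn ht
  have key := integral_mono i2 ((hi.const_mul l).add (i4.const_mul _)) hpath
  simp only [Pi.add_apply] at key
  rw [integral_add (hi.const_mul l) (i4.const_mul _), integral_const_mul, integral_const_mul, m2,
    m4] at key
  have h9 : (3 / (n : ℝ) ^ 2 + 6 / (n : ℝ) ^ 3) ≤ 9 * ρ ^ 4 := by
    have : ρ ^ 4 = 1 / (n : ℝ) ^ 2 := by
      rw [show ρ ^ 4 = (ρ ^ 2) ^ 2 by ring, hρn]; simp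
    rw [this]
    have h63 : 6 / (n : ℝ) ^ 3 ≤ 6 / (n : ℝ) ^ 2 := by
      exact div_le_div_of_nonneg_left (by norm_num) (by positivity)
        (pow_le_pow_right₀ hn' (by norm_num))
    calc _ ≤ 3 / (n : ℝ) ^ 2 + 6 / (n : ℝ) ^ 2 := by gcongr
      _ = _ := by ring
  have h4 : (l ^ 2)⁻¹ * ((t : ℝ) ^ 4 * (3 / (n : ℝ) ^ 2 + 6 / (n : ℝ) ^ 3)) ≤
      (t * ρ) ^ 2 / 4 := by
    calc _ ≤ (l ^ 2)⁻¹ * ((t : ℝ) ^ 4 * (9 * ρ ^ 4)) := by gcongr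
      _ = _ := by rw [hl]; field_simp; norm_num
  have h2 : (t : ℝ) ^ 2 / n = (t * ρ) ^ 2 := by rw [mul_pow, hρn]; ring
  rw [h2] at key
  have hp : 0 < t * ρ := by positivity
  rw [hl] at key
  by_contra! hcon
  nlinarith

end IsGammaTime

/-! ### Constants depending on the triplet, and the convergence rates -/

lemma levyVar_pos {σ : ℝ} {ν : Measure ℝ} (hν : IsLevyMeasure ν)
    (hsq : Integrable (fun x : ℝ => x ^ 2) ν) (h : σ ≠ 0 ∨ ν ≠ 0) : 0 < levyVar σ ν := by
  have hint : 0 ≤ ∫ x, x ^ 2 ∂ν := integral_nonneg fun _ => sq_nonneg _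
  by_contra! hcon
  unfold levyVar at hcon
  have h1 : σ ^ 2 = 0 := by nlinarith [sq_nonneg σ]
  have h2 : ∫ x, x ^ 2 ∂ν = 0 := by nlinarith [sq_nonneg σ]
  rw [integral_eq_zero_iff_of_nonneg (fun _ => sq_nonneg _) hsq] at h2
  rcases h with h | h
  · exact h (by simpa using h1)
  · refine h (Measure.measure_univ_eq_zero.1 ?_)
    rw [← Set.union_compl_self {(0 : ℝ)}]
    refine measure_union_null hν.zero ?_
    rw [Filter.EventuallyEq, ae_iff] at h2
    convert h2 using 2
    ext x
    simp

lemma HasLevyTriplet.hasLinearMoments {Ω : Type*} [MeasurableSpace Ω] {P : Measure Ω}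
    [IsProbabilityMeasure P] {X : ℝ≥0 → Ω → ℝ} {a σ : ℝ} {ν : Measure ℝ}
    (hT : HasLevyTriplet X P a σ ν) (hL : IsLevyProcess X P)
    (hsq : Integrable (fun x : ℝ => x ^ 2) ν) :
    HasLinearMoments X P (levyMean a ν) (levyVar σ ν) where
  memLp h := (hT.moments hL.measurable hsq h).1
  mean h := (hT.moments hL.measurable hsq h).2.1
  var h := (hT.moments hL.measurable hsq h).2.2

/-- The one-dimensional marginals are determined by the triplet. -/
lemma HasLevyTriplet.lintegral_enorm_eq {Ω Ω' : Type*} [MeasurableSpace Ω] [MeasurableSpace Ω']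
    {P : Measure Ω} {P' : Measure Ω'} [IsProbabilityMeasure P] [IsProbabilityMeasure P']
    {X : ℝ≥0 → Ω → ℝ} {X' : ℝ≥0 → Ω' → ℝ} {a σ : ℝ} {ν : Measure ℝ}
    (hX : ∀ s, Measurable (X s)) (hX' : ∀ s, Measurable (X' s))
    (hT : HasLevyTriplet X P a σ ν) (hT' : HasLevyTriplet X' P' a σ ν) (s : ℝ≥0) :
    ∫⁻ ω, ‖X s ω‖ₑ ∂P = ∫⁻ ω, ‖X' s ω‖ₑ ∂P' := by
  have h1 := Measure.isProbabilityMeasure_map (μ := P) (hX s).aemeasurable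
  have h2 := Measure.isProbabilityMeasure_map (μ := P') (hX' s).aemeasurable
  have heq : P.map (X s) = P'.map (X' s) := Measure.ext_of_charFun <| by
    ext θ
    rw [hT, hT']
  rw [← lintegral_map measurable_enorm (hX s), heq, lintegral_map measurable_enorm (hX' s)]

/-- The linear bound on `E|X_h|` for paths of bounded variation holds with a constant depending on
the triplet only. One process of bounded variation provides the constant, and every other process
with the same triplet has the same one-dimensional marginals. -/
lemma exists_lintegral_enorm_le_mul.{u} (a σ : ℝ) {ν : Measure ℝ}
    (hsq : Integrable (fun x : ℝ => x ^ 2) ν) :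
    ∃ C : ℝ, 0 < C ∧ ∀ (Ω : Type u) [MeasurableSpace Ω] (P : Measure Ω) [IsProbabilityMeasure P]
      (X : ℝ≥0 → Ω → ℝ), IsLevyProcess X P → HasLevyTriplet X P a σ ν →
      HasBoundedVariationPaths X P → ∀ h : ℝ≥0, ∫⁻ ω, ‖X h ω‖ₑ ∂P ≤ ENNReal.ofReal (C * h) := by
  by_cases hex : ∃ (Ω : Type u) (_ : MeasurableSpace Ω) (P : Measure Ω)
      (_ : IsProbabilityMeasure P) (X : ℝ≥0 → Ω → ℝ), IsLevyProcess X P ∧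
      HasLevyTriplet X P a σ ν ∧ HasBoundedVariationPaths X P
  · obtain ⟨Ω₀, _, P₀, _, X₀, hL₀, hT₀, hBV₀⟩ := hex
    obtain ⟨C, hC0, hC⟩ := hL₀.exists_lintegral_enorm_le (hT₀.hasLinearMoments hL₀ hsq)
      (levyVar_nonneg σ ν) hBV₀
    refine ⟨C, hC0, fun Ω _ P _ X hL hT _ h => ?_⟩
    rw [HasLevyTriplet.lintegral_enorm_eq hL.measurable hL₀.measurable hT hT₀]
    exact hL₀.lintegral_enorm_le hC h
  · exact ⟨1, one_pos, fun Ω _ P _ X hL hT hBV => absurd ⟨Ω, _, P, ‹_›, X, hL, hT, hBV⟩ hex⟩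

section Conversion

variable {Ω : Type*} [MeasurableSpace Ω] {P : Measure Ω}

lemma integrable_and_integral_le {f : Ω → ℝ} {b : ℝ} (hf : AEMeasurable f P) (hf0 : ∀ ω, 0 ≤ f ω)
    (hb : 0 ≤ b) (h : ∫⁻ ω, ENNReal.ofReal (f ω) ∂P ≤ ENNReal.ofReal b) :
    Integrable f P ∧ ∫ ω, f ω ∂P ≤ b := by
  refine ⟨⟨hf.aestronglyMeasurable, ?_⟩, ?_⟩
  · rw [hasFiniteIntegral_iff_ofReal (ae_of_all _ hf0)]
    exact h.trans_lt ENNReal.ofReal_lt_top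
  · rw [integral_eq_lintegral_of_nonneg_ae (ae_of_all _ hf0) hf.aestronglyMeasurable]
    exact ENNReal.toReal_le_of_le_ofReal hb h

/-- Bounds the first moment through `2 |D| ≤ D² / τ + τ`, a form of the Cauchy–Schwarz
inequality. -/
lemma integral_sq_and_abs_le [IsProbabilityMeasure P] {D : Ω → ℝ} {C τ : ℝ}
    (hD : AEMeasurable D P) (hC : 1 ≤ C) (hτ : 0 < τ)
    (h : ∫⁻ ω, ENNReal.ofReal (D ω ^ 2) ∂P ≤ ENNReal.ofReal (C * τ ^ 2)) :
    (Integrable (fun ω => D ω ^ 2) P ∧ ∫ ω, D ω ^ 2 ∂P ≤ C * τ ^ 2) ∧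
      (Integrable (fun ω => |D ω|) P ∧ ∫ ω, |D ω| ∂P ≤ C * τ) := by
  obtain ⟨hi, hle⟩ := integrable_and_integral_le (hD.pow_const 2) (fun _ => sq_nonneg _)
    (by positivity) h
  have hmem : MemLp D 2 P := (memLp_two_iff_integrable_sq hD.aestronglyMeasurable).2 hi
  have habs : Integrable (fun ω => |D ω|) P := (hmem.integrable one_le_two).abs
  refine ⟨⟨hi, hle⟩, habs, ?_⟩
  have hpath : ∀ ω, |D ω| ≤ (2 * τ)⁻¹ * D ω ^ 2 + τ / 2 := by
    intro ω
    rw [← sq_abs, inv_mul_eq_div, div_add_div _ _ (by positivity) two_ne_zero,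
      le_div_iff₀ (by positivity)]
    nlinarith [sq_nonneg (|D ω| - τ)]
  calc _ ≤ ∫ ω, ((2 * τ)⁻¹ * D ω ^ 2 + τ / 2) ∂P :=
        integral_mono habs ((hi.const_mul _).add (integrable_const _)) hpath
    _ = (2 * τ)⁻¹ * ∫ ω, D ω ^ 2 ∂P + τ / 2 := by
        rw [integral_add (hi.const_mul _) (integrable_const _), integral_const_mul]
        simp
    _ ≤ (2 * τ)⁻¹ * (C * τ ^ 2) + τ / 2 := by gcongr
    _ = (C + 1) / 2 * τ := by field_simp
    _ ≤ C * τ := by gcongr; linarith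

end Conversion

/-- Integrating a quadratic function of the distance of the Gamma time to its mean. -/
lemma IsGammaTime.lintegral_quadratic_le {Ω : Type*} [MeasurableSpace Ω] {P : Measure Ω}
    [IsProbabilityMeasure P] {X : ℝ≥0 → Ω → ℝ} {g : Ω → ℝ≥0} {n : ℕ} {t : ℝ≥0}
    (hg : IsGammaTime g n t X P) (hn : 1 ≤ n) (ht : 0 < t) {ρ : ℝ} (hρ : 0 < ρ)
    (hρn : ρ ^ 2 = 1 / n) {b c : ℝ} (hb : 0 ≤ b) (hc : 0 ≤ c) :
    ∫⁻ ω, ENNReal.ofReal (b * |(g ω : ℝ) - t| + c * |(g ω : ℝ) - t| ^ 2) ∂P ≤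
      ENNReal.ofReal ((b * t + c * t ^ 2) * ρ) := by
  obtain ⟨i2, m2, -, -⟩ := hg.central_moments hn ht
  have i1 := hg.integrable_abs hn ht
  simp_rw [sq_abs]
  have hint : Integrable (fun ω => b * |(g ω : ℝ) - t| + c * ((g ω : ℝ) - t) ^ 2) P :=
    (i1.const_mul b).add (i2.const_mul c)
  rw [← ofReal_integral_eq_lintegral_ofReal hint
    (ae_of_all _ fun ω => add_nonneg (mul_nonneg hb (abs_nonneg _))
      (mul_nonneg hc (sq_nonneg _)))]
  refine ENNReal.ofReal_le_ofReal ?_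
  rw [integral_add (i1.const_mul b) (i2.const_mul c), integral_const_mul, integral_const_mul, m2,
    div_eq_mul_one_div, ← hρn]
  have h1 := mul_le_mul_of_nonneg_left (hg.integral_abs_le hn ht hρ hρn) hb
  have hρ1 : ρ ≤ 1 := by
    have : ρ ^ 2 ≤ 1 := by
      rw [hρn, div_le_one (by positivity)]; exact_mod_cast hn
    nlinarith
  have h2 : c * ((t : ℝ) ^ 2 * ρ ^ 2) ≤ c * ((t : ℝ) ^ 2 * ρ) := by
    gcongr
    nlinarith
  linarith

theorem proposition4p5 (a σ : ℝ) (hσ : 0 ≤ σ) (ν : Measure ℝ) (hν : IsLevyMeasure ν)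
    (hA1 : ∫⁻ x in {x : ℝ | 1 ≤ |x|}, ENNReal.ofReal (x ^ 2) ∂ν < ∞)
    (t : ℝ≥0) (ht : 0 < t) :
    -- upper bounds for second and first moments
    (∃ C : ℝ, 0 < C ∧
      ∀ (Ω : Type*) [MeasurableSpace Ω] (P : Measure Ω) [IsProbabilityMeasure P]
        (X : ℝ≥0 → Ω → ℝ), IsLevyProcess X P → HasLevyTriplet X P a σ ν →
      ∀ (n : ℕ), 1 ≤ n → ∀ g : Ω → ℝ≥0, IsGammaTime g n t X P →
        (Integrable (fun ω => (X (g ω) ω - X t ω) ^ 2) P ∧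
          ∫ ω, (X (g ω) ω - X t ω) ^ 2 ∂P ≤ C * (n : ℝ) ^ (-1 / 2 : ℝ)) ∧
        (Integrable (fun ω => |X (g ω) ω - X t ω|) P ∧
          ∫ ω, |X (g ω) ω - X t ω| ∂P ≤ C * (n : ℝ) ^ (-1 / 4 : ℝ)) ∧
        (Integrable (fun ω => (runningSup X (g ω) ω - runningSup X t ω) ^ 2) P ∧
          ∫ ω, (runningSup X (g ω) ω - runningSup X t ω) ^ 2 ∂P
            ≤ C * (n : ℝ) ^ (-1 / 2 : ℝ)) ∧
        (Integrable (fun ω => |runningSup X (g ω) ω - runningSup X t ω|) P ∧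
          ∫ ω, |runningSup X (g ω) ω - runningSup X t ω| ∂P
            ≤ C * (n : ℝ) ^ (-1 / 4 : ℝ))) ∧
    -- matching lower bound for the second moment of the end point, unless `X` is a pure drift
    (σ ≠ 0 ∨ ν ≠ 0 →
      ∃ c : ℝ, 0 < c ∧
        ∀ (Ω : Type*) [MeasurableSpace Ω] (P : Measure Ω) [IsProbabilityMeasure P]
          (X : ℝ≥0 → Ω → ℝ), IsLevyProcess X P → HasLevyTriplet X P a σ ν →
        ∀ (n : ℕ), 1 ≤ n → ∀ g : Ω → ℝ≥0, IsGammaTime g n t X P →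
          c * (n : ℝ) ^ (-1 / 2 : ℝ) ≤ ∫ ω, (X (g ω) ω - X t ω) ^ 2 ∂P) ∧
    -- sharper first-moment bounds for paths of bounded variation
    (∃ C : ℝ, 0 < C ∧
      ∀ (Ω : Type*) [MeasurableSpace Ω] (P : Measure Ω) [IsProbabilityMeasure P]
        (X : ℝ≥0 → Ω → ℝ), IsLevyProcess X P → HasLevyTriplet X P a σ ν →
        HasBoundedVariationPaths X P →
      ∀ (n : ℕ), 1 ≤ n → ∀ g : Ω → ℝ≥0, IsGammaTime g n t X P →
        (Integrable (fun ω => |X (g ω) ω - X t ω|) P ∧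
          ∫ ω, |X (g ω) ω - X t ω| ∂P ≤ C * (n : ℝ) ^ (-1 / 2 : ℝ)) ∧
        (Integrable (fun ω => |runningSup X (g ω) ω - runningSup X t ω|) P ∧
          ∫ ω, |runningSup X (g ω) ω - runningSup X t ω| ∂P
            ≤ C * (n : ℝ) ^ (-1 / 2 : ℝ))) := by
  have hsq := hν.integrable_sq hA1
  have hv := levyVar_nonneg σ ν
  have ht' : (0 : ℝ) < t := by exact_mod_cast ht
  set κ := levyMean a ν
  set v := levyVar σ ν
  -- the rates: `ρ = n ^ (-1/2)` and `τ = n ^ (-1/4)`, so that `τ ^ 2 = ρ` and `ρ ^ 2 = 1 / n`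
  have hρ : ∀ n : ℕ, 1 ≤ n → 0 < (n : ℝ) ^ (-1 / 2 : ℝ) ∧
      ((n : ℝ) ^ (-1 / 2 : ℝ)) ^ 2 = 1 / n := fun n hn => by
    have hn' : (0 : ℝ) < n := by exact_mod_cast hn
    refine ⟨by positivity, ?_⟩
    rw [← Real.rpow_natCast, ← Real.rpow_mul hn'.le, one_div, ← Real.rpow_neg_one]
    norm_num
  have hτ : ∀ n : ℕ, 1 ≤ n → 0 < (n : ℝ) ^ (-1 / 4 : ℝ) ∧
      ((n : ℝ) ^ (-1 / 4 : ℝ)) ^ 2 = (n : ℝ) ^ (-1 / 2 : ℝ) := fun n hn => by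
    have hn' : (0 : ℝ) < n := by exact_mod_cast hn
    refine ⟨by positivity, ?_⟩
    rw [← Real.rpow_natCast, ← Real.rpow_mul hn'.le]
    norm_num
  refine ⟨⟨8 * v * t + 2 * κ ^ 2 * t ^ 2 + 1, by positivity, ?_⟩, fun hne => ?_, ?_⟩
  · intro Ω _ P _ X hL hT n hn g hg
    have hM : HasLinearMoments X P κ v := hT.hasLinearMoments hL hsq
    obtain ⟨hρ0, hρn⟩ := hρ n hn
    obtain ⟨hτ0, hτρ⟩ := hτ n hn
    have hC : 1 ≤ 8 * v * t + 2 * κ ^ 2 * t ^ 2 + 1 := by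
      have : 0 ≤ 8 * v * t + 2 * κ ^ 2 * t ^ 2 := by positivity
      linarith
    have hend := hL.lintegral_endpoint_sq hM hg.aemeasurable hg.indep t
    have hsup := hL.lintegral_runningSup_sq_le hM hg.aemeasurable hg.indep t
    have h1 := integral_sq_and_abs_le
      (hL.lintegral_endpoint hg.aemeasurable hg.indep t).1 hC hτ0 <| by
        refine hend.trans_le ((hg.lintegral_quadratic_le hn ht hρ0 hρn hv
          (sq_nonneg κ)).trans (ENNReal.ofReal_le_ofReal ?_))
        rw [hτρ]
        refine mul_le_mul_of_nonneg_right ?_ hρ0.le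
        have : 0 ≤ v * t := by positivity
        have : 0 ≤ κ ^ 2 * (t : ℝ) ^ 2 := by positivity
        linarith
    have h2 := integral_sq_and_abs_le
      (hL.lintegral_runningSup hg.aemeasurable hg.indep t).1 hC hτ0 <| by
        refine hsup.trans ((hg.lintegral_quadratic_le hn ht hρ0 hρn (by positivity)
          (by positivity)).trans (ENNReal.ofReal_le_ofReal ?_))
        rw [hτρ]
        exact mul_le_mul_of_nonneg_right (le_add_of_nonneg_right zero_le_one) hρ0.le
    rw [hτρ] at h1 h2
    exact ⟨h1.1, h1.2, h2.1, h2.2⟩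
  · have hvpos : 0 < v := levyVar_pos hν hsq hne
    refine ⟨v * t / 8, by positivity, ?_⟩
    intro Ω _ P _ X hL hT n hn g hg
    have hM : HasLinearMoments X P κ v := hT.hasLinearMoments hL hsq
    obtain ⟨hρ0, hρn⟩ := hρ n hn
    have hend := hL.lintegral_endpoint_sq hM hg.aemeasurable hg.indep t
    have hD := (hL.lintegral_endpoint hg.aemeasurable hg.indep t).1
    obtain ⟨i2, -, -, -⟩ := hg.central_moments hn ht
    have i1 := hg.integrable_abs hn ht
    have hint : Integrable (fun ω => v * |(g ω : ℝ) - t| + κ ^ 2 * |(g ω : ℝ) - t| ^ 2) P := by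
      simp_rw [sq_abs]
      exact (i1.const_mul v).add (i2.const_mul _)
    rw [integral_eq_lintegral_of_nonneg_ae (ae_of_all _ fun _ => sq_nonneg _)
      (hD.pow_const 2).aestronglyMeasurable, hend, ← integral_eq_lintegral_of_nonneg_ae
      (ae_of_all _ fun _ => by positivity) hint.aestronglyMeasurable]
    calc _ = v * (t * (n : ℝ) ^ (-1 / 2 : ℝ) / 8) := by ring
      _ ≤ v * ∫ ω, |(g ω : ℝ) - t| ∂P := by
          gcongr
          exact hg.le_integral_abs hn ht hρ0 hρn
      _ = ∫ ω, v * |(g ω : ℝ) - t| ∂P := (integral_const_mul _ _).symm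
      _ ≤ _ := integral_mono (i1.const_mul v) hint fun ω =>
          le_add_of_nonneg_right (by positivity)
  · obtain ⟨C, hC0, hC⟩ := exists_lintegral_enorm_le_mul a σ hsq
    refine ⟨C * t, by positivity, ?_⟩
    intro Ω _ P _ X hL hT hBV n hn g hg
    obtain ⟨hρ0, hρn⟩ := hρ n hn
    have hCX := hC Ω P X hL hT hBV
    have hend := hL.lintegral_endpoint_abs_le hCX hg.aemeasurable hg.indep t
    have hsup := hL.lintegral_runningSup_abs_le hCX hg.aemeasurable hg.indep t
    have hlin := hg.lintegral_quadratic_le hn ht hρ0 hρn hC0.le le_rfl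
    simp only [zero_mul, add_zero] at hlin
    simp_rw [Real.enorm_eq_ofReal_abs] at hend hsup
    exact ⟨integrable_and_integral_le
        (hL.lintegral_endpoint hg.aemeasurable hg.indep t).1.abs
        (fun _ => abs_nonneg _) (by positivity) (hend.trans hlin),
      integrable_and_integral_le
        (hL.lintegral_runningSup hg.aemeasurable hg.indep t).1.abs
        (fun _ => abs_nonneg _) (by positivity) (hsup.trans hlin)⟩
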